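/- Let $Q$ be a complex Hilbert space (the space $A\otimes B$ of one round), let $n\ge 0$, and let $\rho$ be an arbitrary density operator on $Q^{\otimes n}$. Let $\tilde F$, $F^{\text{test}}_{\text{con}}$, $F^{\text{key}}_{\text{con}}$, $G^{\text{test}}_{\neq}$, $G^{\text{key}}_{\neq}$ be bounded operators on $Q$ with $0\le P\le \mathrm I$ for each of them, and $G^{\text{test}}_{=}=\mathrm I-G^{\text{test}}_{\neq}$, $G^{\text{key}}_{=}=\mathrm I-G^{\text{key}}_{\neq}$. Each round is independently assigned to test with probability $p_T$, to key with probability $p_K$, and discarded with probability $1-p_T-p_K\ge 0$. A measurement outcome with POVM element $P$ changes a (sub-normalized) state $\sigma$ to $\sqrt P\sigma\sqrt P$. The test rounds are measured successively, each by itself, with (1) $\{\tilde F,\mathrm I-\tilde F\}$, discarding the latter outcome, (2) $\{F^{\text{test}}_{\text{con}},\mathrm I-F^{\text{test}}_{\text{con}}\}$, discarding the latter outcome, with $\boldsymbol n_T$ rounds remaining, and (3) $\{G^{\text{test}}_{\neq},G^{\text{test}}_{=}\}$, with $\boldsymbol e^{\text{obs}}=\boldsymbol N_{G^{\text{test}}_{\neq}}/\boldsymbol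 n_T$ the fraction of outcomes $\neq$. The key rounds are measured in the same way with $\tilde F$, $F^{\text{key}}_{\text{con}}$ and $\{G^{\text{key}}_{\neq},G^{\text{key}}_{=}\}$, which gives $\boldsymbol n_K$ remaining rounds after (2) and the error rate $\boldsymbol e^{\text{key}}=\boldsymbol N_{G^{\text{key}}_{\neq}}/\boldsymbol n_K$. Put $$\delta_1=2\left\|\sqrt{F^{\text{key}}_{\text{con}}}\,G^{\text{key}}_{\neq}\sqrt{F^{\text{key}}_{\text{con}}}-\sqrt{F^{\text{test}}_{\text{con}}}\,G^{\text{test}}_{\neq}\sqrt{F^{\text{test}}_{\text{con}}}\right\|_\infty,\qquad \delta_2=\left\|\mathrm I-F^{\text{key}}_{\text{con}}\right\|_\infty,$$ $$\gamma^{\varepsilon}_{\text{serf}}(n_T,n_K)=\sqrt{\frac{\ln(1/\varepsilon^2)}{f_{\text{serf}}(n_T,n_K)}},\qquad f_{\text{serf}}(n_T,n_K)=\frac{n_K n_T^2}{(n_K+n_T)(n_T+1)},$$ $$\gamma^{\varepsilon}_{\text{bin}}(n,\delta)=\inf\Big\{c\ge 0:\ \sum_{n(\delta+c)\le i\le n}\binom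 ni\delta^i(1-\delta)^{n-i}\le\varepsilon^2\Big\},$$ and for $\varepsilon_a,\varepsilon_b,\varepsilon_c>0$ $$\mathcal B_{\delta_1,\delta_2}(e,n_T,n_K)=\frac{e+\gamma^{\varepsilon_a}_{\text{serf}}(n_T,n_K)+\delta_1+\gamma^{\varepsilon_b}_{\text{bin}}(n_K,\delta_1)}{1-\delta_2-\gamma^{\varepsilon_c}_{\text{bin}}(n_K,\delta_2)},$$ with $\mathcal B_{\delta_1,\delta_2}(e,n_T,n_K)=\infty$ if $n_T=0$, or $n_K=0$, or the denominator is not positive. Then $$\Pr\left(\boldsymbol e^{\text{key}}\ge\mathcal B_{\delta_1,\delta_2}(\boldsymbol e^{\text{obs}},\boldsymbol n_T,\boldsymbol n_K)\right)\le\varepsilon_a^2+\varepsilon_b^2+\varepsilon_c^2 .$$ -/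

import Mathlib

open scoped ENNReal

noncomputable section

namespace QKDSampling

/-! ### Hilbert spaces and product operators -/

/-- The complex Hilbert space `ℓ²(κ)`.  Up to the choice of an orthonormal basis every Hilbert space
is of this form, and `ℓ²(κ₁) ⊗ ⋯ ⊗ ℓ²(κₙ) = ℓ²(κ₁ × ⋯ × κₙ)`. -/
def Ell2 (κ : Type*) : Type _ := lp (fun _ : κ => ℂ) 2

instance (κ : Type*) : NormedAddCommGroup (Ell2 κ) :=
  inferInstanceAs (NormedAddCommGroup (lp (fun _ : κ => ℂ) 2))

instance (κ : Type*) : InnerProductSpace ℂ (Ell2 κ) :=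
  inferInstanceAs (InnerProductSpace ℂ (lp (fun _ : κ => ℂ) 2))

instance (κ : Type*) : CompleteSpace (Ell2 κ) :=
  inferInstanceAs (CompleteSpace (lp (fun _ : κ => ℂ) 2))

instance (κ : Type*) : CoeFun (Ell2 κ) fun _ => κ → ℂ := ⟨fun f => f.1⟩

/-- Bounded operators on `ℓ²(κ)`. -/
abbrev Op (κ : Type*) : Type _ := Ell2 κ →L[ℂ] Ell2 κ

theorem norm_sq_eq_tsum {κ : Type*} (f : Ell2 κ) : ‖f‖ₑ ^ 2 = ∑' a, ‖f a‖ₑ ^ 2 := by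
  have h : HasSum (fun a => ‖f a‖ ^ (2 : ℝ≥0∞).toReal) (‖f‖ ^ (2 : ℝ≥0∞).toReal) :=
    lp.hasSum_norm (E := fun _ : κ => ℂ) (p := 2) (by norm_num) f
  simp only [ENNReal.toReal_ofNat, Real.rpow_two] at h
  have h2 : ∀ z : ℝ, 0 ≤ z → ENNReal.ofReal (z ^ 2) = ENNReal.ofReal z ^ 2 := fun z hz =>
    ENNReal.ofReal_pow hz 2
  calc ‖f‖ₑ ^ 2 = ENNReal.ofReal (‖f‖ ^ 2) := by rw [h2 _ (norm_nonneg _), ofReal_norm]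
    _ = ∑' a, ENNReal.ofReal (‖f a‖ ^ 2) := by
        rw [← h.tsum_eq, ENNReal.ofReal_tsum_of_nonneg (fun _ => by positivity) h.summable]
    _ = ∑' a, ‖f a‖ₑ ^ 2 := by
        refine tsum_congr fun a => ?_
        rw [h2 _ (norm_nonneg _), ofReal_norm]

theorem memEll2 {κ : Type*} {f : κ → ℂ} (h : ∑' a, ‖f a‖ₑ ^ 2 ≠ ∞) : Memℓp f 2 := by
  refine memℓp_gen ?_
  have := ENNReal.summable_toReal h
  refine this.congr fun a => ?_
  simp

/-- For `X ≃ ι × Y`, the section of `f ∈ ℓ²(X)` through `x` in the direction of `ι`. -/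
def fiber {X Y ι : Type*} (e : X ≃ ι × Y) (f : Ell2 X) (y : Y) : Ell2 ι :=
  ⟨fun a => f (e.symm (a, y)), memEll2 (by
    refine ne_top_of_le_ne_top (b := ‖f‖ₑ ^ 2) (by finiteness) ?_
    rw [norm_sq_eq_tsum]
    exact ENNReal.tsum_comp_le_tsum_of_injective (f := fun a => e.symm (a, y))
      (fun a b hab => by simpa using hab) (fun x => ‖f x‖ₑ ^ 2))⟩

theorem ampl_bound {X Y ι : Type*} (e : X ≃ ι × Y) (E : Op ι) (f : Ell2 X) :
    ∑' x, ‖E (fiber e f (e x).2) (e x).1‖ₑ ^ 2 ≤ (‖E‖ₑ * ‖f‖ₑ) ^ 2 := by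
  have key : ∀ g : ι × Y → ℝ≥0∞, ∑' x, g (e x) = ∑' y, ∑' a, g (a, y) := fun g => by
    rw [e.tsum_eq g, ENNReal.tsum_prod', ENNReal.tsum_comm]
  calc ∑' x, ‖E (fiber e f (e x).2) (e x).1‖ₑ ^ 2
      = ∑' y, ∑' a, ‖E (fiber e f y) a‖ₑ ^ 2 :=
        key fun p => ‖E (fiber e f p.2) p.1‖ₑ ^ 2
    _ = ∑' y, ‖E (fiber e f y)‖ₑ ^ 2 := by simp_rw [norm_sq_eq_tsum]
    _ ≤ ∑' y, ‖E‖ₑ ^ 2 * ‖fiber e f y‖ₑ ^ 2 := by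
        refine ENNReal.tsum_le_tsum fun y => ?_
        rw [← mul_pow]
        gcongr
        exact E.le_opENorm _
    _ = ‖E‖ₑ ^ 2 * ∑' y, ∑' a, ‖f (e.symm (a, y))‖ₑ ^ 2 := by
        rw [ENNReal.tsum_mul_left]
        simp_rw [norm_sq_eq_tsum]
        rfl
    _ = ‖E‖ₑ ^ 2 * ∑' x, ‖f x‖ₑ ^ 2 := by
        rw [← key fun p => ‖f (e.symm p)‖ₑ ^ 2]
        refine congrArg _ (tsum_congr fun x => ?_)
        exact congrArg (fun z => ‖f z‖ₑ ^ 2) (e.symm_apply_apply x)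
    _ = (‖E‖ₑ * ‖f‖ₑ) ^ 2 := by rw [← norm_sq_eq_tsum, mul_pow]

/-- For `X ≃ ι × Y`, that is `ℓ²(X) = ℓ²(ι) ⊗ ℓ²(Y)`, the vector `(E ⊗ 1) f`. -/
def amplFun {X Y ι : Type*} (e : X ≃ ι × Y) (E : Op ι) (f : Ell2 X) : Ell2 X :=
  ⟨fun x => E (fiber e f (e x).2) (e x).1,
    memEll2 (ne_top_of_le_ne_top (by finiteness) (ampl_bound e E f))⟩

/-- For `X ≃ ι × Y`, that is `ℓ²(X) = ℓ²(ι) ⊗ ℓ²(Y)`, the operator `E ⊗ 1`. -/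
def ampl {X Y ι : Type*} (e : X ≃ ι × Y) (E : Op ι) : Op X :=
  LinearMap.mkContinuous
    { toFun := amplFun e E
      map_add' := fun f g => by
        refine Subtype.ext (funext fun x => ?_)
        have h : fiber e (f + g) (e x).2 = fiber e f (e x).2 + fiber e g (e x).2 := rfl
        change E (fiber e (f + g) (e x).2) (e x).1 = _
        rw [h, map_add]
        rfl
      map_smul' := fun c f => by
        refine Subtype.ext (funext fun x => ?_)
        have h : fiber e (c • f) (e x).2 = c • fiber e f (e x).2 := rfl
        change E (fiber e (c • f) (e x).2) (e x).1 = _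
        rw [h, map_smul]
        rfl }
    ‖E‖ (fun f => by
      have h := ampl_bound e E f
      have h0 : ‖amplFun e E f‖ₑ ^ 2 ≤ (‖E‖ₑ * ‖f‖ₑ) ^ 2 := by
        rw [norm_sq_eq_tsum]
        exact h
      have h1 : ‖amplFun e E f‖ₑ ≤ ‖E‖ₑ * ‖f‖ₑ := (ENNReal.pow_le_pow_left_iff two_ne_zero).1 h0
      have h2 := ENNReal.toReal_mono (by finiteness) h1
      change ‖amplFun e E f‖ ≤ ‖E‖ * ‖f‖
      simpa using h2)

/-- The operator `E` acting on the `i`-th of `n` rounds. -/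
def slot {n : ℕ} {ι : Type*} (i : Fin n) (E : Op ι) : Op (Fin n → ι) :=
  ampl (Equiv.funSplitAt i ι) E

/-- The operator `K₁ ⊗ ⋯ ⊗ Kₙ` on the space `ℓ²(ι)^{⊗ n} = ℓ²(ι ^ n)` of `n` rounds. -/
def tensorOp {n : ℕ} {ι : Type*} (K : Fin n → Op ι) : Op (Fin n → ι) :=
  (List.ofFn fun i => slot i (K i)).prod

open Classical in
/-- The standard basis vectors of `ℓ²(κ)`. -/
def basisVec {κ : Type*} (a : κ) : Ell2 κ := lp.single (E := fun _ : κ => ℂ) 2 a (1 : ℂ)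

/-- The trace `∑ₐ ⟨eₐ, T eₐ⟩ ∈ [0, ∞]` of a positive operator `T`. -/
def trace {κ : Type*} (T : Op κ) : ℝ≥0∞ :=
  ∑' a, ENNReal.ofReal (inner ℂ (basisVec a) (T (basisVec a))).re

/-- Density operators: positive operators of trace one. -/
def IsState {κ : Type*} (ρ : Op κ) : Prop := 0 ≤ ρ ∧ trace ρ = 1

/-- POVM elements: `0 ≤ P ≤ 1`.  They correspond to the two-outcome POVMs `{P, 1 - P}`. -/
def IsEffect {κ : Type*} (P : Op κ) : Prop := 0 ≤ P ∧ P ≤ 1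

/-! ### The protocol -/

/-- What a round is assigned to. -/
inductive Label
  | test
  | key
  | discard
  deriving DecidableEq

instance : Fintype Label := ⟨{.test, .key, .discard}, fun l => by cases l <;> decide⟩

/-- What happens to a round: it is removed by the common filter, it passes the common filter but is
removed afterwards, or it is kept and gives an error or no error. -/
inductive Outcome
  | commonReject
  | laterReject
  | error
  | noError
  deriving DecidableEq

instance : Fintype Outcome :=
  ⟨{.commonReject, .laterReject, .error, .noError}, fun o => by cases o <;> decide⟩

/-- The single-round measurements.  `Fcom` is the filter common to all rounds, `Ftest`, `Fkey` are the
second filters, and `Gtest`, `Gkey` are the POVM elements for an error. -/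
structure Measurements (ι : Type*) where
  Fcom : Op ι
  Ftest : Op ι
  Gtest : Op ι
  Fkey : Op ι
  Gkey : Op ι

/-- All five operators are POVM elements. -/
structure Measurements.Valid {ι : Type*} (M : Measurements ι) : Prop where
  Fcom : IsEffect M.Fcom
  Ftest : IsEffect M.Ftest
  Gtest : IsEffect M.Gtest
  Fkey : IsEffect M.Fkey
  Gkey : IsEffect M.Gkey

/-- Kraus operators of the successive measurements `{Fcom, 1 - Fcom}`, `{F, 1 - F}`, `{G, 1 - G}`,
where a measurement is followed by the next one only if the outcome is not discarded; an outcome `P`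
of a measurement changes a state `ρ` to `√P ρ √P`. -/
def krausChain {ι : Type*} (Fcom F G : Op ι) : Outcome → Op ι
  | .commonReject => CFC.sqrt (1 - Fcom)
  | .laterReject => CFC.sqrt (1 - F) * CFC.sqrt Fcom
  | .error => CFC.sqrt G * CFC.sqrt F * CFC.sqrt Fcom
  | .noError => CFC.sqrt (1 - G) * CFC.sqrt F * CFC.sqrt Fcom

/-- The Kraus operators for one round, given what it is assigned to.  A round that is assigned to
neither test nor key goes through the common filter and is then dropped. -/
def kraus {ι : Type*} (M : Measurements ι) : Label → Outcome → Op ι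
  | .test, o => krausChain M.Fcom M.Ftest M.Gtest o
  | .key, o => krausChain M.Fcom M.Fkey M.Gkey o
  | .discard, .commonReject => CFC.sqrt (1 - M.Fcom)
  | .discard, .laterReject => CFC.sqrt M.Fcom
  | .discard, _ => 0

/-- The probabilities with which a round is assigned to test, to key, and to neither. -/
def labelProb (pT pK : ℝ) : Label → ℝ
  | .test => pT
  | .key => pK
  | .discard => 1 - pT - pK

/-- The joint probability that the `n` rounds are assigned as `s` (independently) and that the
measurements on the state `ρ` of all rounds give the outcomes `o`, namely
`(∏ᵢ p(sᵢ)) · tr (K ρ K†)` with `K = ⊗ᵢ K_{sᵢ,oᵢ}`. -/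
def jointProb {n : ℕ} {ι : Type*} (M : Measurements ι) (pT pK : ℝ) (ρ : Op (Fin n → ι))
    (s : Fin n → Label) (o : Fin n → Outcome) : ℝ≥0∞ :=
  ENNReal.ofReal (∏ i, labelProb pT pK (s i)) *
    trace (tensorOp (fun i => kraus M (s i) (o i)) * ρ *
      star (tensorOp (fun i => kraus M (s i) (o i))))

open Classical in
/-- The probability of an event that depends on the assignment and on the outcomes. -/
def prob {n : ℕ} {ι : Type*} (M : Measurements ι) (pT pK : ℝ) (ρ : Op (Fin n → ι))
    (A : (Fin n → Label) → (Fin n → Outcome) → Prop) : ℝ≥0∞ :=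
  ∑ s : Fin n → Label, ∑ o : Fin n → Outcome, if A s o then jointProb M pT pK ρ s o else 0

/-- The number of rounds that are assigned to `l` and give an error. -/
def numError {n : ℕ} (l : Label) (s : Fin n → Label) (o : Fin n → Outcome) : ℕ :=
  (Finset.univ.filter fun i => s i = l ∧ o i = .error).card

/-- The number of rounds that are assigned to `l` and pass both filters. -/
def numKept {n : ℕ} (l : Label) (s : Fin n → Label) (o : Fin n → Outcome) : ℕ :=
  (Finset.univ.filter fun i => s i = l ∧ (o i = .error ∨ o i = .noError)).card

/-- The error rate among the rounds that are assigned to `l` and pass both filters. -/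
def errorRate {n : ℕ} (l : Label) (s : Fin n → Label) (o : Fin n → Outcome) : ℝ :=
  numError l s o / numKept l s o

/-! ### The bound -/

/-- `f_serf(nT, nK) = nK nT² / ((nK + nT) (nT + 1))`. -/
def fSerf (nT nK : ℕ) : ℝ := (nK * nT ^ 2 : ℝ) / ((nK + nT) * (nT + 1))

/-- `γ_serf^ε(nT, nK) = √(ln (1 / ε²) / f_serf(nT, nK))`. -/
def gammaSerf (ε : ℝ) (nT nK : ℕ) : ℝ := Real.sqrt (Real.log (1 / ε ^ 2) / fSerf nT nK)

/-- `∑_{n (δ + c) ≤ i ≤ n} (n choose i) δ^i (1 - δ)^(n - i)`. -/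
def binTail (n : ℕ) (δ c : ℝ) : ℝ :=
  ∑ i ∈ (Finset.range (n + 1)).filter (fun i : ℕ => (n : ℝ) * (δ + c) ≤ i),
    (n.choose i : ℝ) * δ ^ i * (1 - δ) ^ (n - i)

/-- `γ_bin^ε(n, δ)`: the value at `ε²` of the generalized inverse of `c ↦ binTail n δ c` on `c ≥ 0`.
The tail is a non-increasing step function of `c`, so that the equation `binTail n δ c = ε ^ 2` need not
have a solution; a solution `c ≥ 0`, if there is one, is at least `gammaBin ε n δ`. -/
def gammaBin (ε : ℝ) (n : ℕ) (δ : ℝ) : ℝ := sInf {c : ℝ | 0 ≤ c ∧ binTail n δ c ≤ ε ^ 2}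

/-- `δ₁ = 2 ‖√Fkey Gkey √Fkey - √Ftest Gtest √Ftest‖`. -/
def delta1 {ι : Type*} (M : Measurements ι) : ℝ :=
  2 * ‖CFC.sqrt M.Fkey * M.Gkey * CFC.sqrt M.Fkey -
    CFC.sqrt M.Ftest * M.Gtest * CFC.sqrt M.Ftest‖

/-- `δ₂ = ‖1 - Fkey‖`. -/
def delta2 {ι : Type*} (M : Measurements ι) : ℝ := ‖1 - M.Fkey‖

open Classical in
/-- The bound on the error rate of the key rounds.  It is `∞` if no test round or no key round is
left, and if the denominator is not positive. -/
def bound (εa εb εc δ₁ δ₂ e : ℝ) (nT nK : ℕ) : EReal :=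
  if nT = 0 ∨ nK = 0 ∨ 1 - δ₂ - gammaBin εc nK δ₂ ≤ 0 then ⊤
  else (((e + gammaSerf εa nT nK + δ₁ + gammaBin εb nK δ₁) /
    (1 - δ₂ - gammaBin εc nK δ₂) : ℝ) : EReal)

end QKDSampling

end

/-!
Everything is reduced to one positive multilinear functional.  Writing `v a = √ρ eₐ`, the functional
`ω T = ∑ₐ re ⟨v a, T (v a)⟩` is positive with `ω 1 = 1`, and the probability of a sequence of results
is `ω (A₁ ⊗ ⋯ ⊗ Aₙ)` with one POVM element `Aᵢ` per round (`IsState.exists_expectation`,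
`roundOp`).  This uses that operators on different slots commute (`commute_slot`).

Fix the number `t` of test rounds that pass the common filter and the number `n` of key rounds that
pass both filters.  With `θ = 1 - δ₂`, `2 d = δ₁`, and error numbers `E_T`, `E_K`, the event in
question forces `θ E_K / n - E_T / t ≥ γ + 2 d` with `γ² (1 / n + 1 / t)⁻¹ = ln (1 / εa²)`: the second
test filter only lowers the number of test rounds, the Serfling term decreases in it, and the
binomial corrections are nonnegative, so that they only enlarge the bound (`le_of_bound_le`).  Hence
it is enough to control the moment generating function
`Ψ(l) = ∑ exp (l (θ E_K / n - E_T / t)) ω(A₁ ⊗ ⋯ ⊗ Aₙ)` over the results with these `t` and `n`,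
namely to show `Ψ(l) ≤ exp (2 d l + (1 / n + 1 / t) l² / 4) Ψ(0)` (`moment_le`).  Chernoff's bound
with `l = 2 γ / (1 / n + 1 / t)` then gives `εa²` times the probability of the pair `(t, n)`, and
summing over `(t, n)` gives the theorem.

The bound on `Ψ` follows from `Ψ' ≤ (2 d + (1 / n + 1 / t) l / 2) Ψ`.  As the test rounds are a random
subset, `n t Ψ'` is a sum over ordered pairs of rounds, one of which is a key round and the other one a
test round, and exchanging the roles of the two rounds permutes the terms of this sum
(`pairForm_swap`).  It therefore suffices to have an inequality for a symmetric positive bilinear form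
in the operators of two rounds, `pair_inequality`.  It involves only sums of products of positive
operators on different rounds, so that entanglement between the rounds and the noncommutativity of
the test and key measurements do no harm.
-/

namespace QKDSampling

/-! ### The algebra of product operators -/

section Ampliation

variable {X Y ι : Type*}

theorem fiber_ampl (e : X ≃ ι × Y) (E : Op ι) (f : Ell2 X) (y : Y) :
    fiber e (ampl e E f) y = E (fiber e f y) := by
  refine Subtype.ext (funext fun a => ?_)
  change E (fiber e f (e (e.symm (a, y))).2) (e (e.symm (a, y))).1 = _
  rw [e.apply_symm_apply]

theorem ampl_one (e : X ≃ ι × Y) : ampl e (1 : Op ι) = 1 := by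
  ext f : 1
  refine Subtype.ext (funext fun x => ?_)
  change f (e.symm ((e x).1, (e x).2)) = f x
  rw [Prod.mk.eta, e.symm_apply_apply]

theorem ampl_mul (e : X ≃ ι × Y) (A B : Op ι) : ampl e (A * B) = ampl e A * ampl e B := by
  ext f : 1
  refine Subtype.ext (funext fun x => ?_)
  change A (B (fiber e f (e x).2)) (e x).1 = A (fiber e (ampl e B f) (e x).2) (e x).1
  rw [fiber_ampl]

theorem hasSum_inner_ell2 {κ : Type*} (f g : Ell2 κ) :
    HasSum (fun a => inner ℂ (f a) (g a)) (inner ℂ f g) :=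
  lp.hasSum_inner (G := fun _ : κ => ℂ) f g

/-- The inner product of `ℓ²(ι) ⊗ ℓ²(Y)` is the sum of the inner products of the fibers. -/
theorem hasSum_inner_fiber (e : X ≃ ι × Y) (f g : Ell2 X) :
    HasSum (fun y => inner ℂ (fiber e f y) (fiber e g y)) (inner ℂ f g) := by
  have h := hasSum_inner_ell2 f g
  rw [← ((Equiv.prodComm Y ι).trans e.symm).hasSum_iff] at h
  exact h.prod_fiberwise fun y => hasSum_inner_ell2 (fiber e f y) (fiber e g y)

theorem star_ampl (e : X ≃ ι × Y) (A : Op ι) : star (ampl e A) = ampl e (star A) := by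
  refine ((ContinuousLinearMap.eq_adjoint_iff _ _).2 fun f g => ?_).symm
  refine (hasSum_inner_fiber e _ _).unique ?_
  convert hasSum_inner_fiber e f (ampl e A g) using 2 with y
  rw [fiber_ampl, fiber_ampl]
  exact ContinuousLinearMap.adjoint_inner_left A _ _

end Ampliation

section Basis

variable {κ : Type*}

theorem smul_ell2_apply (c : ℂ) (f : Ell2 κ) (a : κ) : (c • f) a = c * f a := rfl

theorem basisVec_apply [DecidableEq κ] (a b : κ) :
    (basisVec a : Ell2 κ) b = if b = a then 1 else 0 := by
  have h := @lp.single_apply κ (fun _ => ℂ) _ (Classical.decEq κ) 2 a (1 : ℂ) b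
  change (basisVec a : Ell2 κ) b = _ at h
  rw [h]
  by_cases hb : b = a
  · subst hb; simp
  · simp [hb]

theorem hasSum_basisVec (f : Ell2 κ) : HasSum (fun a => f a • basisVec a) f := by
  classical
  have h := lp.hasSum_single (E := fun _ : κ => ℂ) (p := 2) (by norm_num) f
  have h2 : ∀ a, f a • basisVec a =
      (lp.single (E := fun _ : κ => ℂ) 2 a (f a) : Ell2 κ) := fun a => by
    refine Subtype.ext (funext fun b => ?_)
    change f a * (basisVec a : Ell2 κ) b = _
    rw [basisVec_apply, lp.single_apply]
    by_cases hb : b = a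
    · subst hb; simp
    · simp [hb]
  simp only [h2]
  exact h

/-- Bounded operators are determined by their matrix elements in the standard basis. -/
theorem op_ext {A B : Op κ} (h : ∀ a b, A (basisVec a) b = B (basisVec a) b) : A = B := by
  ext f : 1
  refine ((hasSum_basisVec f).mapL A).unique ?_
  convert (hasSum_basisVec f).mapL B using 2 with a
  rw [map_smul, map_smul]
  congr 1
  exact Subtype.ext (funext fun b => h a b)

theorem inner_basisVec (a : κ) (f : Ell2 κ) : inner ℂ (basisVec a) f = f a := by
  classical
  refine (hasSum_inner_ell2 _ f).unique ?_
  convert hasSum_ite_eq a (f a) using 2 with b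
  rw [basisVec_apply]
  by_cases hb : b = a
  · subst hb; simp
  · simp [hb]

end Basis

section Slots

variable {n : ℕ} {ι : Type*}

theorem fiber_funSplitAt_apply (i : Fin n) (f : Ell2 (Fin n → ι)) (x : Fin n → ι) (a : ι) :
    fiber (Equiv.funSplitAt i ι) f (Equiv.funSplitAt i ι x).2 a = f (Function.update x i a) := by
  change f ((Equiv.funSplitAt i ι).symm (a, _)) = _
  refine congrArg _ (funext fun k => ?_)
  by_cases hk : k = i
  · subst hk; simp [Equiv.funSplitAt]
  · simp [Equiv.funSplitAt, hk]

/-- Matrix elements of the operators on two different slots, from which it is visible that these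
operators commute. -/
theorem slot_mul_slot_basisVec {i j : Fin n} (hij : i ≠ j) (A B : Op ι) (a x : Fin n → ι)
    [Decidable (∀ k, k ≠ i → k ≠ j → x k = a k)] :
    (slot i A * slot j B) (basisVec a) x =
      if ∀ k, k ≠ i → k ≠ j → x k = a k then
        A (basisVec (a i)) (x i) * B (basisVec (a j)) (x j) else 0 := by
  classical
  have h1 : ∀ y, fiber (Equiv.funSplitAt j ι) (basisVec a) (Equiv.funSplitAt j ι y).2 =
      (if ∀ k, k ≠ j → y k = a k then (1 : ℂ) else 0) • basisVec (a j) := fun y => by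
    refine Subtype.ext (funext fun b => ?_)
    refine (fiber_funSplitAt_apply j _ y b).trans ?_
    change _ = _ * (basisVec (a j) : Ell2 ι) b
    rw [basisVec_apply, basisVec_apply]
    have h0 : Function.update y j b = a ↔ b = a j ∧ ∀ k, k ≠ j → y k = a k :=
      Function.update_eq_iff
    simp only [h0]
    by_cases hb : b = a j <;> simp [hb]
  have h2 : ∀ y, slot j B (basisVec a) y =
      (if ∀ k, k ≠ j → y k = a k then (1 : ℂ) else 0) * B (basisVec (a j)) (y j) := fun y => by
    change B (fiber _ _ _) _ = _
    rw [h1, map_smul]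
    rfl
  have h3 : fiber (Equiv.funSplitAt i ι) (slot j B (basisVec a)) (Equiv.funSplitAt i ι x).2 =
      ((if ∀ k, k ≠ i → k ≠ j → x k = a k then (1 : ℂ) else 0) *
        B (basisVec (a j)) (x j)) • basisVec (a i) := by
    refine Subtype.ext (funext fun b => ?_)
    refine (fiber_funSplitAt_apply i _ x b).trans ?_
    change _ = _ * (basisVec (a i) : Ell2 ι) b
    rw [h2, Function.update_of_ne hij.symm, basisVec_apply]
    have h4 : (∀ k, k ≠ j → Function.update x i b k = a k) ↔
        b = a i ∧ ∀ k, k ≠ i → k ≠ j → x k = a k := by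
      refine ⟨fun h => ⟨by simpa using h i hij, fun k hk hk' => ?_⟩, fun h k hk => ?_⟩
      · simpa [hk] using h k hk'
      · by_cases hki : k = i
        · subst hki; simpa using h.1
        · simpa [hki] using h.2 k hki hk
    simp only [h4]
    by_cases hb : b = a i <;> simp [hb]
  change A (fiber (Equiv.funSplitAt i ι) (slot j B (basisVec a)) (Equiv.funSplitAt i ι x).2) (x i) = _
  rw [h3, map_smul]
  rw [smul_ell2_apply]
  split_ifs <;> simp [mul_comm]

theorem commute_slot {i j : Fin n} (hij : i ≠ j) (A B : Op ι) : Commute (slot i A) (slot j B) := by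
  classical
  refine op_ext fun a x => ?_
  rw [slot_mul_slot_basisVec hij, slot_mul_slot_basisVec hij.symm]
  have h : (∀ k, k ≠ i → k ≠ j → x k = a k) ↔ ∀ k, k ≠ j → k ≠ i → x k = a k :=
    forall_congr' fun _ => forall_comm
  simp only [h, mul_comm]

theorem slot_one (i : Fin n) : slot i (1 : Op ι) = 1 := ampl_one _

theorem slot_mul (i : Fin n) (A B : Op ι) : slot i (A * B) = slot i A * slot i B := ampl_mul _ _ _

theorem star_slot (i : Fin n) (A : Op ι) : star (slot i A) = slot i (star A) := star_ampl _ _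

theorem commute_list_prod_slot {l : List (Fin n)} {i : Fin n} (hi : i ∉ l) (A : Op ι)
    (K : Fin n → Op ι) : Commute (slot i A) (l.map fun k => slot k (K k)).prod := by
  refine Commute.list_prod_right _ _ fun B hB => ?_
  obtain ⟨k, hk, rfl⟩ := List.mem_map.1 hB
  exact commute_slot (fun h => hi (by rwa [h])) _ _

theorem list_prod_slot_mul {l : List (Fin n)} (hl : l.Nodup) (K L : Fin n → Op ι) :
    (l.map fun k => slot k (K k * L k)).prod =
      (l.map fun k => slot k (K k)).prod * (l.map fun k => slot k (L k)).prod := by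
  induction l with
  | nil => simp
  | cons i l ih =>
    obtain ⟨hi, hl⟩ := List.nodup_cons.1 hl
    simp only [List.map_cons, List.prod_cons, ih hl]
    rw [slot_mul, mul_assoc, mul_assoc, ← mul_assoc (slot i (L i)),
      (commute_list_prod_slot hi (L i) K).eq, mul_assoc]

theorem star_list_prod_slot {l : List (Fin n)} (hl : l.Nodup) (K : Fin n → Op ι) :
    star (l.map fun k => slot k (K k)).prod = (l.map fun k => slot k (star (K k))).prod := by
  induction l with
  | nil => simp
  | cons i l ih =>
    obtain ⟨hi, hl⟩ := List.nodup_cons.1 hl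
    simp only [List.map_cons, List.prod_cons, star_mul, ih hl, star_slot]
    exact (commute_list_prod_slot hi _ _).eq.symm

theorem list_prod_slot_update {l : List (Fin n)} (hl : l.Nodup) {i : Fin n} (A : Op ι) :
    (l.map fun k => slot k (Function.update (1 : Fin n → Op ι) i A k)).prod =
      if i ∈ l then slot i A else 1 := by
  induction l with
  | nil => simp
  | cons j l ih =>
    obtain ⟨hj, hl⟩ := List.nodup_cons.1 hl
    simp only [List.map_cons, List.prod_cons, ih hl]
    by_cases hij : i = j
    · subst hij; simp [hj]
    · simp [hij, Ne.symm hij, slot_one]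

theorem tensorOp_eq (K : Fin n → Op ι) :
    tensorOp K = ((List.finRange n).map fun k => slot k (K k)).prod := by
  rw [tensorOp, List.ofFn_eq_map]

theorem tensorOp_mul (K L : Fin n → Op ι) : tensorOp (K * L) = tensorOp K * tensorOp L := by
  simp only [tensorOp_eq]
  exact list_prod_slot_mul (List.nodup_finRange n) K L

theorem star_tensorOp (K : Fin n → Op ι) : star (tensorOp K) = tensorOp (star K) := by
  simp only [tensorOp_eq]
  exact star_list_prod_slot (List.nodup_finRange n) K

theorem tensorOp_one : tensorOp (1 : Fin n → Op ι) = 1 := by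
  simp [tensorOp_eq, slot_one]

/-- A product operator depends on its `i`-th factor through `slot i`, which is linear. -/
theorem tensorOp_update (K : Fin n → Op ι) (i : Fin n) (A : Op ι) :
    tensorOp (Function.update K i A) = tensorOp (Function.update K i 1) * slot i A := by
  have h : tensorOp (Function.update (1 : Fin n → Op ι) i A) = slot i A := by
    rw [tensorOp_eq, list_prod_slot_update (List.nodup_finRange n), if_pos (List.mem_finRange i)]
  rw [← h, ← tensorOp_mul]
  congr 1
  funext k
  by_cases hk : k = i
  · subst hk; simp
  · simp [hk]

/-- `K₁ ⊗ ⋯ ⊗ Kₙ` as a multilinear map. -/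
noncomputable def tensorMap (n : ℕ) (ι : Type*) :
    MultilinearMap ℝ (fun _ : Fin n => Op ι) (Op (Fin n → ι)) where
  toFun := tensorOp
  map_update_add' K i A B := by
    have h : ∀ [DecidableEq (Fin n)] (C : Op ι),
        tensorOp (Function.update K i C) = tensorOp (Function.update K i 1) * slot i C := by
      intro inst C
      rw [Subsingleton.elim inst (instDecidableEqFin n)]
      exact tensorOp_update K i C
    rw [h, h A, h B, ← mul_add]
    -- `slot i` is additive by definition
    rfl
  map_update_smul' K i c A := by
    have h : ∀ [DecidableEq (Fin n)] (C : Op ι),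
        tensorOp (Function.update K i C) = tensorOp (Function.update K i 1) * slot i C := by
      intro inst C
      rw [Subsingleton.elim inst (instDecidableEqFin n)]
      exact tensorOp_update K i C
    rw [h, h A, ← mul_smul_comm]
    rfl

theorem tensorOp_nonneg {K : Fin n → Op ι} (hK : ∀ i, 0 ≤ K i) : 0 ≤ tensorOp K := by
  have h : K = star (fun i => CFC.sqrt (K i)) * fun i => CFC.sqrt (K i) := by
    funext i
    change K i = star (CFC.sqrt (K i)) * CFC.sqrt (K i)
    rw [(CFC.sqrt_nonneg (K i)).isSelfAdjoint.star_eq, CFC.sqrt_mul_sqrt_self _ (hK i)]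
  rw [h, tensorOp_mul, ← star_tensorOp]
  exact star_mul_self_nonneg _

end Slots

/-! ### Expectation values -/

section Expectation

variable {κ : Type*}

theorem trace_mul_star (B : Op κ) : trace (B * star B) = ∑' a, ‖B (basisVec a)‖ₑ ^ 2 := by
  have h1 : ∀ a, ENNReal.ofReal (inner ℂ (basisVec a) ((B * star B) (basisVec a))).re =
      ∑' b, ‖B (basisVec b) a‖ₑ ^ 2 := fun a => by
    have h2 : (inner ℂ (basisVec a) ((B * star B) (basisVec a)) : ℂ) =
        inner ℂ (star B (basisVec a)) (star B (basisVec a)) :=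
      (ContinuousLinearMap.adjoint_inner_left B _ _).symm
    have h3 : (inner ℂ (star B (basisVec a)) (star B (basisVec a)) : ℂ).re =
        ‖star B (basisVec a)‖ ^ 2 := inner_self_eq_norm_sq (𝕜 := ℂ) _
    rw [h2, h3, ENNReal.ofReal_pow (norm_nonneg _), ofReal_norm, norm_sq_eq_tsum]
    refine tsum_congr fun b => ?_
    have h4 : (star B (basisVec a)) b = star (B (basisVec b) a) := by
      rw [← inner_basisVec b, ← inner_basisVec a]
      refine (ContinuousLinearMap.adjoint_inner_right B _ _).trans ?_
      exact (inner_conj_symm _ _).symm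
    rw [h4, ← ofReal_norm, norm_star, ofReal_norm]
  rw [trace]
  simp only [h1]
  rw [ENNReal.tsum_comm]
  simp only [norm_sq_eq_tsum]

/-- A density operator `ρ` defines a positive normalized functional `ω`, which at `K† K` is the
probability `tr (K ρ K†)` of an outcome with Kraus operator `K`. -/
theorem IsState.exists_expectation {ρ : Op κ} (hρ : IsState ρ) :
    ∃ ω : Op κ →ₗ[ℝ] ℝ, (∀ T, 0 ≤ T → 0 ≤ ω T) ∧ ω 1 = 1 ∧
      ∀ K : Op κ, trace (K * ρ * star K) = ENNReal.ofReal (ω (star K * K)) := by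
  set v : κ → Ell2 κ := fun a => CFC.sqrt ρ (basisVec a) with hv
  have hstar : star (CFC.sqrt ρ) = CFC.sqrt ρ := (CFC.sqrt_nonneg ρ).isSelfAdjoint.star_eq
  have htrace : ∀ K : Op κ, trace (K * ρ * star K) = ∑' a, ‖K (v a)‖ₑ ^ 2 := fun K => by
    rw [← CFC.sqrt_mul_sqrt_self ρ hρ.1]
    have h : K * (CFC.sqrt ρ * CFC.sqrt ρ) * star K =
        (K * CFC.sqrt ρ) * star (K * CFC.sqrt ρ) := by
      rw [star_mul, hstar]; simp only [mul_assoc]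
    rw [h, trace_mul_star]
    rfl
  have hone : ∑' a, ‖v a‖ₑ ^ 2 = 1 := by
    have h := htrace 1
    simp only [one_mul, star_one, mul_one, hρ.2] at h
    exact h.symm
  have hsum : Summable fun a => ‖v a‖ ^ 2 := by
    have h := ENNReal.summable_toReal (f := fun a => ‖v a‖ₑ ^ 2) (by rw [hone]; simp)
    exact h.congr fun a => by simp
  have hsumT : ∀ T : Op κ, Summable fun a => (inner ℂ (v a) (T (v a)) : ℂ).re := fun T => by
    refine Summable.of_norm_bounded (hsum.mul_left ‖T‖) fun a => ?_
    calc ‖(inner ℂ (v a) (T (v a)) : ℂ).re‖ ≤ ‖(inner ℂ (v a) (T (v a)) : ℂ)‖ :=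
          Complex.abs_re_le_norm _
      _ ≤ ‖v a‖ * ‖T (v a)‖ := norm_inner_le_norm _ _
      _ ≤ ‖v a‖ * (‖T‖ * ‖v a‖) := by gcongr; exact T.le_opNorm _
      _ = ‖T‖ * ‖v a‖ ^ 2 := by ring
  have hK : ∀ (K : Op κ) (a : κ),
      (inner ℂ (v a) ((star K * K) (v a)) : ℂ).re = ‖K (v a)‖ ^ 2 := fun K a => by
    have h : (inner ℂ (v a) ((star K * K) (v a)) : ℂ) = inner ℂ (K (v a)) (K (v a)) :=
      ContinuousLinearMap.adjoint_inner_right K _ _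
    rw [h]
    exact inner_self_eq_norm_sq (𝕜 := ℂ) _
  have htr : ∀ K : Op κ, trace (K * ρ * star K) =
      ENNReal.ofReal (∑' a, (inner ℂ (v a) ((star K * K) (v a)) : ℂ).re) := fun K => by
    have hs := hsumT (star K * K)
    simp only [hK] at hs ⊢
    rw [htrace, ENNReal.ofReal_tsum_of_nonneg (fun _ => by positivity) hs]
    refine tsum_congr fun a => ?_
    rw [ENNReal.ofReal_pow (norm_nonneg _), ofReal_norm]
  refine ⟨⟨⟨fun T => ∑' a, (inner ℂ (v a) (T (v a)) : ℂ).re, fun S T => ?_⟩, fun c T => ?_⟩,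
    fun T hT => ?_, ?_, htr⟩
  · rw [← (hsumT S).tsum_add (hsumT T)]
    exact tsum_congr fun a => by simp
  · change _ = c * _
    rw [← tsum_mul_left]
    refine tsum_congr fun a => ?_
    have h : (c • T) (v a) = (c : ℂ) • T (v a) := rfl
    rw [h, inner_smul_right, Complex.re_ofReal_mul]
  · refine tsum_nonneg fun a => ?_
    exact ((ContinuousLinearMap.nonneg_iff_isPositive T).1 hT).re_inner_nonneg_right (v a)
  · change ∑' a, (inner ℂ (v a) (v a) : ℂ).re = 1
    have h : ∀ a, (inner ℂ (v a) (v a) : ℂ).re = (‖v a‖ₑ ^ 2).toReal := fun a => by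
      have := inner_self_eq_norm_sq (𝕜 := ℂ) (v a)
      simpa using this
    simp only [h]
    rw [← ENNReal.tsum_toReal_eq (fun a => by finiteness), hone, ENNReal.toReal_one]

end Expectation

/-! ### The inequality for a pair of rounds -/

/-- The inequality for two rounds behind the bound on the moment generating function.  Here `e`, `F`,
`P`, `S` stand for the POVM elements of passing the common filter, of a kept key round, of an error in
a key round and of an error in a test round; `α` and `E` are the weights of the two kinds of error.

After `F + (α - 1) P` has been replaced by its lower bound `θ ((e - P) + α P)`, all terms except those
with the difference `P - S` are combinations of `β P P`, `β P (e - P)` and `β (e - P) (e - P)`, and the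
constant `C = (α - E) / (α + E)` makes the mixed terms cancel.  The terms with `P - S` are absorbed by
the remaining ones and by the contribution of `2 d`. -/
theorem pair_inequality {V : Type*} [AddCommGroup V] [PartialOrder V] [IsOrderedAddMonoid V]
    [Module ℝ V] [PosSMulMono ℝ V] (β : V →ₗ[ℝ] V →ₗ[ℝ] ℝ) (hsymm : ∀ x y, β x y = β y x)
    (hpos : ∀ x y, 0 ≤ x → 0 ≤ y → 0 ≤ β x y) {e P S F : V} {θ d α E : ℝ}
    (hP : 0 ≤ P) (hPF : P ≤ F) (hF : θ • e ≤ F) (hFe : F ≤ e) (hS : 0 ≤ S) (hSe : S ≤ e)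
    (hPS : P - S ≤ d • e)
    (hθ : 0 ≤ θ) (hθ1 : θ ≤ 1) (hd : 0 ≤ d) (hα : 1 ≤ α) (hE : 0 < E) (hE1 : E ≤ 1) :
    θ * α * β P (e - (1 - E) • S) - E * β (F + (α - 1) • P) S ≤
      ((α - E) / (α + E) + 2 * d) * β (F + (α - 1) • P) (e - (1 - E) • S) := by
  set C := (α - E) / (α + E) with hC
  have hαE : 0 < α + E := by linarith
  have hCeq : C * (α + E) = α - E := div_mul_cancel₀ _ hαE.ne'
  have hC0 : 0 ≤ C := div_nonneg (by linarith) hαE.le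
  have hC1 : C ≤ 1 := (div_le_one hαE).2 (by linarith)
  have hC2 : 1 - C ≤ 2 * E := by
    have : (1 - C) * (α + E) = 2 * E := by linarith
    nlinarith
  have he : 0 ≤ e := hS.trans hSe
  have hPe : P ≤ e := hPF.trans hFe
  set V' := e - (1 - E) • S with hV'
  set A := (e - P) + α • P with hA
  have hb : 0 ≤ 1 - E := by linarith
  -- `V'` lies above `E e`
  have hVE : E • e ≤ V' := by
    have h : V' - E • e = (1 - E) • (e - S) := by rw [hV']; module
    exact sub_nonneg.1 (h ▸ smul_nonneg hb (sub_nonneg.2 hSe))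
  have hV0 : 0 ≤ V' := (smul_nonneg hE.le he).trans hVE
  -- `U` may be replaced by its lower bound `θ A`
  have hUA : θ • A ≤ F + (α - 1) • P := by
    have h : F + (α - 1) • P - θ • A = (F - θ • e) + ((1 - θ) * (α - 1)) • P := by
      rw [hA]; module
    refine sub_nonneg.1 (h ▸ add_nonneg (sub_nonneg.2 hF) (smul_nonneg ?_ hP))
    exact mul_nonneg (by linarith) (by linarith)
  -- the estimates for the two components of the difference operator
  have h1 : (1 - C * (1 - E)) • (P - S) ≤ (C * E) • P + (2 * d) • V' := by
    have h : (C * E) • P + (2 * d) • V' - (1 - C * (1 - E)) • (P - S) =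
        (C * E) • S + (1 - C) • (d • e - (P - S)) + ((2 * E - (1 - C)) * d) • e +
          (2 * d) • (V' - E • e) := by module
    refine sub_nonneg.1 (h ▸ ?_)
    have i1 := smul_nonneg (mul_nonneg hC0 hE.le) hS
    have i2 := smul_nonneg (sub_nonneg.2 hC1) (sub_nonneg.2 hPS)
    have i3 := smul_nonneg (mul_nonneg (sub_nonneg.2 hC2) hd) he
    have i4 := smul_nonneg (mul_nonneg zero_le_two hd) (sub_nonneg.2 hVE)
    exact add_nonneg (add_nonneg (add_nonneg i1 i2) i3) i4
  have h2 : (E - C * (1 - E)) • (P - S) ≤ C • (e - P) + (2 * d) • V' := by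
    -- a positive coefficient is at most `E`, and for a negative one `S - P ≤ e - P` helps
    rcases le_total 0 (E - C * (1 - E)) with hc | hc
    · have h : C • (e - P) + (2 * d) • V' - (E - C * (1 - E)) • (P - S) =
          C • (e - P) + (E - C * (1 - E)) • (d • e - (P - S)) +
            ((2 * E - (E - C * (1 - E))) * d) • e + (2 * d) • (V' - E • e) := by module
      refine sub_nonneg.1 (h ▸ ?_)
      have i1 := smul_nonneg hC0 (sub_nonneg.2 hPe)
      have i2 := smul_nonneg hc (sub_nonneg.2 hPS)
      have i3 : 0 ≤ ((2 * E - (E - C * (1 - E))) * d) • e := by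
        refine smul_nonneg (mul_nonneg ?_ hd) he
        nlinarith
      have i4 := smul_nonneg (mul_nonneg zero_le_two hd) (sub_nonneg.2 hVE)
      exact add_nonneg (add_nonneg (add_nonneg i1 i2) i3) i4
    · have h : C • (e - P) + (2 * d) • V' - (E - C * (1 - E)) • (P - S) =
          (C - (C * (1 - E) - E)) • (e - P) + (C * (1 - E) - E) • (e - S) +
            (2 * d) • V' := by module
      refine sub_nonneg.1 (h ▸ ?_)
      have i1 : 0 ≤ (C - (C * (1 - E) - E)) • (e - P) := by
        refine smul_nonneg ?_ (sub_nonneg.2 hPe)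
        nlinarith
      have i2 : 0 ≤ (C * (1 - E) - E) • (e - S) :=
        smul_nonneg (by linarith) (sub_nonneg.2 hSe)
      have i4 := smul_nonneg (mul_nonneg zero_le_two hd) hV0
      exact add_nonneg (add_nonneg i1 i2) i4
  have hmain : α * β P V' - E * β A S - (C + 2 * d) * β A V' ≤ 0 := by
    have k1 := hpos _ _ hP (sub_nonneg.2 h1)
    have k2 := hpos _ _ (sub_nonneg.2 hPe) (sub_nonneg.2 h2)
    have hid : α * β P V' - E * β A S - (C + 2 * d) * β A V' =
        (α - E - C * (α + E)) * β P (e - P)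
        - α * β P ((C * E) • P + (2 * d) • V' - (1 - C * (1 - E)) • (P - S))
        - β (e - P) (C • (e - P) + (2 * d) • V' - (E - C * (1 - E)) • (P - S)) := by
      simp only [hA, hV', map_add, map_sub, map_smul, LinearMap.add_apply, LinearMap.sub_apply,
        LinearMap.smul_apply, smul_eq_mul, hsymm e P]
      ring
    rw [hid, hCeq, sub_self, zero_mul]
    have := mul_nonneg (zero_le_one.trans hα) k1
    linarith
  have hUV := hpos _ _ (sub_nonneg.2 hUA) hV0
  have hUS := hpos _ _ (sub_nonneg.2 hUA) hS
  simp only [map_sub, map_smul, LinearMap.sub_apply, LinearMap.smul_apply, smul_eq_mul] at hUV hUS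
  have k1 := mul_nonneg hE.le hUS
  have k2 := mul_nonneg (add_nonneg hC0 (mul_nonneg zero_le_two hd)) hUV
  have k3 := mul_nonneg hθ (neg_nonneg.2 hmain)
  nlinarith

/-! ### Sums over pairs of rounds -/

section Pairs

variable {κ V : Type*} [Fintype κ] [AddCommGroup V] [Module ℝ V] {N : ℕ}

/-- The number of rounds whose result belongs to the class `l`. -/
def classCount (cls : κ → Label) (l : Label) (z : Fin N → κ) : ℕ :=
  (Finset.univ.filter fun i => cls (z i) = l).card

/-- The results of all rounds with `t` rounds of class `test` and `n` rounds of class `key`. -/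
def classFiber (cls : κ → Label) (t n : ℕ) : Finset (Fin N → κ) :=
  Finset.univ.filter fun z => classCount cls .test z = t ∧ classCount cls .key z = n

theorem mem_classFiber {cls : κ → Label} {t n : ℕ} {z : Fin N → κ} : z ∈ classFiber cls t n ↔
    classCount cls .test z = t ∧ classCount cls .key z = n := by
  simp [classFiber]

theorem update_mem_classFiber {cls : κ → Label} {t n : ℕ} {z : Fin N → κ} {i : Fin N} {q : κ}
    (h : cls q = cls (z i)) :
    Function.update z i q ∈ classFiber cls t n ↔ z ∈ classFiber cls t n := by
  have h2 : ∀ k, cls (Function.update z i q k) = cls (z k) := fun k => by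
    by_cases hk : k = i
    · subst hk; simp [h]
    · simp [hk]
  simp only [mem_classFiber, classCount, h2]

theorem comp_perm_mem_classFiber {cls : κ → Label} {t n : ℕ} {z : Fin N → κ}
    (σ : Equiv.Perm (Fin N)) :
    z ∘ σ ∈ classFiber cls t n ↔ z ∈ classFiber cls t n := by
  have h : ∀ l, classCount cls l (z ∘ σ) = classCount cls l z := fun l => by
    refine Finset.card_equiv σ fun i => ?_
    simp
  simp only [mem_classFiber, h]

variable [DecidableEq κ]

/-- The bilinear form that remains of the sum over a `classFiber` when the operators `x`, `y` are
put on the rounds `i`, `j`; these two rounds count as a key round and as a test round.  The results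
`qK`, `qT` only serve as placeholders of these classes. -/
noncomputable def pairForm (m : MultilinearMap ℝ (fun _ : Fin N => V) ℝ) (A : κ → V)
    (cls : κ → Label) (t n : ℕ) (qK qT : κ) (i j : Fin N) (hij : i ≠ j) : V →ₗ[ℝ] V →ₗ[ℝ] ℝ :=
  LinearMap.mk₂ ℝ
    (fun x y => ∑ z ∈ (classFiber cls t n).filter (fun z => z i = qK ∧ z j = qT),
      m (Function.update (Function.update (A ∘ z) i x) j y))
    (fun x x' y => by
      simp only [Function.update_comm hij, MultilinearMap.map_update_add, Finset.sum_add_distrib])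
    (fun c x y => by
      simp only [Function.update_comm hij, MultilinearMap.map_update_smul, Finset.smul_sum])
    (fun x y y' => by
      simp only [MultilinearMap.map_update_add, Finset.sum_add_distrib])
    (fun c x y => by
      simp only [MultilinearMap.map_update_smul, Finset.smul_sum])

theorem pairForm_apply (m : MultilinearMap ℝ (fun _ : Fin N => V) ℝ) (A : κ → V)
    (cls : κ → Label) (t n : ℕ) (qK qT : κ) (i j : Fin N) (hij : i ≠ j) (x y : V) :
    pairForm m A cls t n qK qT i j hij x y =
      ∑ z ∈ (classFiber cls t n).filter (fun z => z i = qK ∧ z j = qT),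
        m (Function.update (Function.update (A ∘ z) i x) j y) := rfl

variable (m : MultilinearMap ℝ (fun _ : Fin N => V) ℝ) (A : κ → V) {cls : κ → Label} (t n : ℕ)
  {qK qT : κ} {i j : Fin N}

/-- Exchanging two rounds permutes the results with given class counts. -/
theorem pairForm_swap (hij : i ≠ j) (x y : V) :
    pairForm m A cls t n qK qT j i hij.symm x y = pairForm m A cls t n qK qT i j hij y x := by
  rw [pairForm_apply, pairForm_apply]
  refine Finset.sum_nbij' (fun z => z ∘ Equiv.swap i j) (fun z => z ∘ Equiv.swap i j)
    ?_ ?_ ?_ ?_ ?_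
  · intro z hz
    rw [Finset.mem_filter] at hz ⊢
    rw [comp_perm_mem_classFiber]
    simpa using hz
  · intro z hz
    rw [Finset.mem_filter] at hz ⊢
    rw [comp_perm_mem_classFiber]
    simpa using hz
  · intro z _
    funext k; simp
  · intro z _
    funext k; simp
  · intro z _
    congr 1
    funext k
    by_cases hki : k = i
    · subst hki; simp [hij]
    by_cases hkj : k = j
    · subst hkj; simp [hki]
    · simp [hki, hkj, Equiv.swap_apply_of_ne_of_ne hki hkj]

theorem sum_classFiber_eq_pairForm (hK : cls qK = .key) (hT : cls qT = .test) (hij : i ≠ j)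
    {q q' : κ} (hq : cls q = .key) (hq' : cls q' = .test) :
    ∑ z ∈ (classFiber cls t n).filter (fun z => z i = q ∧ z j = q'), m (A ∘ z) =
      pairForm m A cls t n qK qT i j hij (A q) (A q') := by
  have aux : ∀ {a b c d : κ}, cls a = cls c → cls b = cls d → ∀ z : Fin N → κ,
      z ∈ (classFiber cls t n).filter (fun z => z i = a ∧ z j = b) →
      Function.update (Function.update z i c) j d ∈
        (classFiber cls t n).filter (fun z => z i = c ∧ z j = d) := by
    intro a b c d hac hbd z hz
    rw [Finset.mem_filter] at hz ⊢
    obtain ⟨hz, rfl, rfl⟩ := hz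
    rw [update_mem_classFiber (by simp [hij.symm, hbd]), update_mem_classFiber hac.symm]
    simp [hz, hij]
  have aux2 : ∀ {a b c d : κ} (z : Fin N → κ),
      z ∈ (classFiber cls t n).filter (fun z => z i = a ∧ z j = b) →
      Function.update (Function.update (Function.update (Function.update z i c) j d) i a) j b =
        z := by
    intro a b c d z hz
    rw [Finset.mem_filter] at hz
    obtain ⟨hz, rfl, rfl⟩ := hz
    funext k
    by_cases hkj : k = j
    · subst hkj; simp
    by_cases hki : k = i
    · subst hki; simp [hkj]
    · simp [hki, hkj]
  rw [pairForm_apply]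
  refine Finset.sum_nbij' (fun z => Function.update (Function.update z i qK) j qT)
    (fun z => Function.update (Function.update z i q) j q')
    (aux (hq.trans hK.symm) (hq'.trans hT.symm)) (aux (hK.trans hq.symm) (hT.trans hq'.symm))
    aux2 aux2 ?_
  intro z hz
  obtain ⟨hz, rfl, rfl⟩ := Finset.mem_filter.1 hz
  congr 1
  funext k
  by_cases hkj : k = j
  · subst hkj; simp
  by_cases hki : k = i
  · subst hki; simp [hkj]
  · simp [hki, hkj]

theorem sum_mul_eq_pairForm (hK : cls qK = .key) (hT : cls qT = .test) (hij : i ≠ j)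
    {f g : κ → ℝ} (hf : ∀ q, f q ≠ 0 → cls q = .key) (hg : ∀ q, g q ≠ 0 → cls q = .test) :
    ∑ z ∈ classFiber cls t n, f (z i) * g (z j) * m (A ∘ z) =
      pairForm m A cls t n qK qT i j hij (∑ q, f q • A q) (∑ q, g q • A q) := by
  have h1 : ∀ z : Fin N → κ, f (z i) * g (z j) * m (A ∘ z) =
      ∑ q, ∑ q', if z i = q ∧ z j = q' then f q * g q' * m (A ∘ z) else 0 := fun z => by
    rw [Finset.sum_eq_single (z i), Finset.sum_eq_single (z j)]
    · simp
    · intro b _ hb; simp [hb.symm]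
    · simp
    · intro b _ hb; simp [hb.symm]
    · simp
  have h2 : pairForm m A cls t n qK qT i j hij (∑ q, f q • A q) (∑ q, g q • A q) =
      ∑ q, ∑ q', f q * g q' * pairForm m A cls t n qK qT i j hij (A q) (A q') := by
    simp only [map_sum, LinearMap.sum_apply, map_smul, LinearMap.smul_apply, smul_eq_mul,
      Finset.mul_sum]
    rw [Finset.sum_comm]
    exact Finset.sum_congr rfl fun q _ => Finset.sum_congr rfl fun q' _ => by ring
  rw [h2]
  simp only [h1]
  rw [Finset.sum_comm]
  refine Finset.sum_congr rfl fun q _ => ?_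
  rw [Finset.sum_comm]
  refine Finset.sum_congr rfl fun q' _ => ?_
  rw [← Finset.sum_filter, ← Finset.mul_sum]
  by_cases hfq : f q = 0
  · simp [hfq]
  by_cases hgq : g q' = 0
  · simp [hgq]
  rw [sum_classFiber_eq_pairForm m A t n hK hT hij (hf q hfq) (hg q' hgq)]

/-- A sum over pairs of a key round and a test round, symmetrized in the two rounds.  The diagonal
terms vanish since no result belongs to both classes. -/
theorem sum_classFiber_mul_mul (hK : cls qK = .key) (hT : cls qT = .test)
    {f g : κ → ℝ} (hf : ∀ q, f q ≠ 0 → cls q = .key) (hg : ∀ q, g q ≠ 0 → cls q = .test) :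
    2 * ∑ z ∈ classFiber cls t n, (∑ i, f (z i)) * (∑ j, g (z j)) * m (A ∘ z) =
      ∑ i, ∑ j, if hij : i ≠ j then
        (pairForm m A cls t n qK qT i j hij + (pairForm m A cls t n qK qT i j hij).flip)
          (∑ q, f q • A q) (∑ q, g q • A q) else 0 := by
  have h1 : ∑ z ∈ classFiber cls t n, (∑ i, f (z i)) * (∑ j, g (z j)) * m (A ∘ z) =
      ∑ i, ∑ j, if hij : i ≠ j then pairForm m A cls t n qK qT i j hij
        (∑ q, f q • A q) (∑ q, g q • A q) else 0 := by
    simp only [Finset.sum_mul_sum]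
    simp only [Finset.sum_mul]
    rw [Finset.sum_comm]
    refine Finset.sum_congr rfl fun i _ => ?_
    rw [Finset.sum_comm]
    refine Finset.sum_congr rfl fun j _ => ?_
    by_cases hij : i = j
    · subst hij
      simp only [ne_eq, not_true_eq_false, dite_false]
      refine Finset.sum_eq_zero fun z _ => ?_
      by_cases h : f (z i) = 0
      · simp [h]
      by_cases h' : g (z i) = 0
      · simp [h']
      exact absurd ((hf _ h).symm.trans (hg _ h')) (by decide)
    · rw [dif_pos hij]
      exact sum_mul_eq_pairForm m A t n hK hT hij hf hg
  have h2 : ∑ z ∈ classFiber cls t n, (∑ i, f (z i)) * (∑ j, g (z j)) * m (A ∘ z) =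
      ∑ i, ∑ j, if hij : i ≠ j then pairForm m A cls t n qK qT i j hij
        (∑ q, g q • A q) (∑ q, f q • A q) else 0 := by
    rw [h1, Finset.sum_comm]
    refine Finset.sum_congr rfl fun j _ => Finset.sum_congr rfl fun i _ => ?_
    by_cases hij : i = j
    · subst hij; simp
    · rw [dif_pos hij, dif_pos (Ne.symm hij), pairForm_swap]
  rw [two_mul]
  nth_rewrite 1 [h1]
  rw [h2, ← Finset.sum_add_distrib]
  refine Finset.sum_congr rfl fun i _ => ?_
  rw [← Finset.sum_add_distrib]
  refine Finset.sum_congr rfl fun j _ => ?_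
  by_cases hij : i = j
  · subst hij; simp
  · rw [dif_pos hij, dif_pos hij, dif_pos hij, LinearMap.add_apply, LinearMap.add_apply,
      LinearMap.flip_apply]

end Pairs

/-! ### The moment generating function -/

section Moments

/-- The inequality `tanh x ≤ x` for `x = (u - v) / 2`. -/
theorem exp_sub_exp_div_le {u v : ℝ} (huv : v ≤ u) :
    (Real.exp u - Real.exp v) / (Real.exp u + Real.exp v) ≤ (u - v) / 2 := by
  have key : ∀ x : ℝ, 0 ≤ x → Real.exp x - 1 ≤ x / 2 * (Real.exp x + 1) := by
    intro x hx
    have hd : ∀ y : ℝ, HasDerivAt (fun y => y / 2 * (Real.exp y + 1) - (Real.exp y - 1))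
        (1 / 2 * (Real.exp y + 1) + y / 2 * Real.exp y - Real.exp y) y := fun y =>
      (((hasDerivAt_id y).div_const 2).mul ((Real.hasDerivAt_exp y).add_const 1)).sub
        ((Real.hasDerivAt_exp y).sub_const 1)
    have hmono : MonotoneOn (fun y => y / 2 * (Real.exp y + 1) - (Real.exp y - 1)) (Set.Ici 0) := by
      refine monotoneOn_of_hasDerivWithinAt_nonneg (convex_Ici 0)
        (fun y _ => (hd y).continuousAt.continuousWithinAt)
        (fun y _ => (hd y).hasDerivWithinAt) fun y _ => ?_
      have h1 := Real.add_one_le_exp (-y)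
      have h2 := mul_le_mul_of_nonneg_left h1 (Real.exp_pos y).le
      rw [← Real.exp_add, add_neg_cancel, Real.exp_zero] at h2
      linarith
    have h := hmono (Set.self_mem_Ici) (Set.mem_Ici.2 hx) hx
    simp only [Real.exp_zero] at h
    linarith
  rw [div_le_iff₀ (by positivity)]
  have h := mul_le_mul_of_nonneg_left (key (u - v) (sub_nonneg.2 huv)) (Real.exp_pos v).le
  have h1 : Real.exp v * Real.exp (u - v) = Real.exp u := by rw [← Real.exp_add]; ring_nf
  have h2 : Real.exp v * (Real.exp (u - v) - 1) = Real.exp u - Real.exp v := by rw [← h1]; ring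
  have h3 : Real.exp v * ((u - v) / 2 * (Real.exp (u - v) + 1)) =
      (u - v) / 2 * (Real.exp u + Real.exp v) := by rw [← h1]; ring
  linarith

/-- Grönwall's inequality for an exponential sum. -/
theorem sum_exp_le_of_deriv_le {ι : Type*} (s : Finset ι) (c x : ι → ℝ) {a b : ℝ}
    (h : ∀ l, 0 ≤ l → ∑ i ∈ s, x i * (Real.exp (l * x i) * c i) ≤
      (a + 2 * b * l) * ∑ i ∈ s, Real.exp (l * x i) * c i) {l : ℝ} (hl : 0 ≤ l) :
    ∑ i ∈ s, Real.exp (l * x i) * c i ≤ Real.exp (a * l + b * l ^ 2) * ∑ i ∈ s, c i := by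
  set g : ℝ → ℝ := fun l => (∑ i ∈ s, Real.exp (l * x i) * c i) * Real.exp (-(a * l + b * l ^ 2))
    with hg
  have hd : ∀ l, HasDerivAt g
      ((∑ i ∈ s, x i * (Real.exp (l * x i) * c i) -
        (a + 2 * b * l) * ∑ i ∈ s, Real.exp (l * x i) * c i) *
          Real.exp (-(a * l + b * l ^ 2))) l := fun l => by
    have h1 : HasDerivAt (fun l => ∑ i ∈ s, Real.exp (l * x i) * c i)
        (∑ i ∈ s, x i * (Real.exp (l * x i) * c i)) l := by
      refine HasDerivAt.fun_sum fun i _ => ?_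
      exact (((hasDerivAt_id' l).mul_const (x i)).exp.mul_const (c i)).congr_deriv (by ring)
    have h3 : HasDerivAt (fun l : ℝ => -(a * l + b * l ^ 2)) (-(a + 2 * b * l)) l := by
      exact ((((hasDerivAt_id' l).const_mul a).add ((hasDerivAt_pow 2 l).const_mul b)).neg).congr_deriv
        (by push_cast; ring)
    exact (h1.mul h3.exp).congr_deriv (by ring)
  have hanti : AntitoneOn g (Set.Ici 0) := by
    refine antitoneOn_of_hasDerivWithinAt_nonpos (convex_Ici 0)
      (fun y _ => (hd y).continuousAt.continuousWithinAt)
      (fun y _ => (hd y).hasDerivWithinAt) fun y hy => ?_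
    rw [interior_Ici] at hy
    exact mul_nonpos_of_nonpos_of_nonneg (sub_nonpos.2 (h y (le_of_lt hy))) (Real.exp_pos _).le
  have h1 := hanti Set.self_mem_Ici (Set.mem_Ici.2 hl) hl
  have h0 : g 0 = ∑ i ∈ s, c i := by simp [hg]
  rw [h0] at h1
  have h2 := mul_le_mul_of_nonneg_left h1 (Real.exp_pos (a * l + b * l ^ 2)).le
  have h3 : Real.exp (a * l + b * l ^ 2) * g l = ∑ i ∈ s, Real.exp (l * x i) * c i := by
    rw [hg, mul_comm, mul_assoc, ← Real.exp_add, neg_add_cancel, Real.exp_zero, mul_one]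
  rwa [h3] at h2

variable {κ V : Type*} [Fintype κ] [DecidableEq κ] [AddCommGroup V] [PartialOrder V]
  [Module ℝ V] {N : ℕ}

theorem pairForm_nonneg {m : MultilinearMap ℝ (fun _ : Fin N => V) ℝ}
    (hm : ∀ x, (∀ i, 0 ≤ x i) → 0 ≤ m x) {A : κ → V} (hA : ∀ q, 0 ≤ A q) (cls : κ → Label)
    (t n : ℕ) (qK qT : κ) {i j : Fin N} (hij : i ≠ j) {x y : V} (hx : 0 ≤ x) (hy : 0 ≤ y) :
    0 ≤ pairForm m A cls t n qK qT i j hij x y := by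
  rw [pairForm_apply]
  refine Finset.sum_nonneg fun z _ => hm _ fun k => ?_
  by_cases hkj : k = j
  · subst hkj; simpa using hy
  by_cases hki : k = i
  · subst hki; simpa [hkj] using hx
  · simpa [hkj, hki] using hA (z k)

variable [IsOrderedAddMonoid V] [PosSMulMono ℝ V]

/-- The differential inequality for the moment generating function, in terms of the operators
`w q • A q` that are weighted by `α` for an error in a key round and by `E` for an error in a test
round. -/
theorem sum_classFiber_error_le {m : MultilinearMap ℝ (fun _ : Fin N => V) ℝ}
    (hm : ∀ x, (∀ i, 0 ≤ x i) → 0 ≤ m x) {A : κ → V} (hA : ∀ q, 0 ≤ A q) {cls : κ → Label}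
    {qK qT : κ} (hK : cls qK = .key) (hT : cls qT = .test) {e P S F : V} {pK pT θ d α E : ℝ}
    (hpK : 0 ≤ pK) (hpT : 0 ≤ pT)
    (hP : 0 ≤ P) (hPF : P ≤ F) (hF : θ • e ≤ F) (hFe : F ≤ e) (hS : 0 ≤ S) (hSe : S ≤ e)
    (hPS : P - S ≤ d • e)
    (hθ : 0 ≤ θ) (hθ1 : θ ≤ 1) (hd : 0 ≤ d) (hα : 1 ≤ α) (hE : 0 < E) (hE1 : E ≤ 1)
    (hAK : A qK = pK • P) (hAT : A qT = pT • S)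
    (hsumK : ∑ q, (if cls q = .key then (1 : ℝ) else 0) • A q = pK • F)
    (hsumT : ∑ q, (if cls q = .test then (1 : ℝ) else 0) • A q = pT • e)
    {w : κ → ℝ} (hw : w = fun q => if q = qK then α else if q = qT then E else 1) (t n : ℕ) :
    ∑ z ∈ classFiber cls t n, (θ * t * (∑ i, if z i = qK then (1 : ℝ) else 0) -
        n * (∑ i, if z i = qT then (1 : ℝ) else 0)) * m ((fun q => w q • A q) ∘ z) ≤
      ((α - E) / (α + E) + 2 * d) * (n * t * ∑ z ∈ classFiber cls t n,
        m ((fun q : κ => w q • A q) ∘ z)) := by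
  set A' : κ → V := fun q => w q • A q with hA'
  have hKT : qK ≠ qT := fun h => by rw [h, hT] at hK; exact absurd hK (by decide)
  have hw0 : ∀ q, 0 ≤ w q := fun q => by
    rw [hw]
    dsimp only
    split_ifs <;> linarith
  have hA'0 : ∀ q, 0 ≤ A' q := fun q => smul_nonneg (hw0 q) (hA q)
  have hcount : ∀ (l : Label) (z : Fin N → κ),
      (∑ i, if cls (z i) = l then (1 : ℝ) else 0) = classCount cls l z := fun l z => by
    simp [classCount]
  set fP : κ → ℝ := fun q => if q = qK then 1 else 0 with hfP
  set fU : κ → ℝ := fun q => if cls q = .key then 1 else 0 with hfU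
  set gS : κ → ℝ := fun q => if q = qT then 1 else 0 with hgS
  set gV : κ → ℝ := fun q => if cls q = .test then 1 else 0 with hgV
  have sP : ∀ q, fP q ≠ 0 → cls q = .key := fun q hq => by
    by_cases h : q = qK
    · rw [h, hK]
    · simp [hfP, h] at hq
  have sU : ∀ q, fU q ≠ 0 → cls q = .key := fun q hq => by
    by_contra h
    simp [hfU, h] at hq
  have sS : ∀ q, gS q ≠ 0 → cls q = .test := fun q hq => by
    by_cases h : q = qT
    · rw [h, hT]
    · simp [hgS, h] at hq
  have sV : ∀ q, gV q ≠ 0 → cls q = .test := fun q hq => by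
    by_contra h
    simp [hgV, h] at hq
  have eP : ∑ q, fP q • A' q = (pK * α) • P := by
    have h : ∑ q, fP q • A' q = A' qK := by simp [hfP, ite_smul]
    rw [h]
    simp [hA', hw, hAK, smul_smul, mul_comm]
  have eS : ∑ q, gS q • A' q = (pT * E) • S := by
    have h : ∑ q, gS q • A' q = A' qT := by simp [hgS, ite_smul]
    rw [h]
    simp [hA', hw, hAT, smul_smul, mul_comm, hKT.symm]
  have eU : ∑ q, fU q • A' q = pK • (F + (α - 1) • P) := by
    have h : ∀ q, fU q • A' q = fU q • A q + (α - 1) • fP q • A q := fun q => by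
      by_cases h1 : q = qK
      · subst h1
        simp only [hfU, hfP, hA', hw, hK, if_true]
        module
      · by_cases h2 : q = qT
        · subst h2; simp [hfU, hfP, hT, h1]
        · simp [hfU, hfP, hA', hw, h1, h2]
    simp only [h]
    rw [Finset.sum_add_distrib, hsumK, ← Finset.smul_sum]
    have h3 : ∑ q, fP q • A q = pK • P := by simp [hfP, ite_smul, hAK]
    rw [h3]
    module
  have eV : ∑ q, gV q • A' q = pT • (e - (1 - E) • S) := by
    have h : ∀ q, gV q • A' q = gV q • A q - (1 - E) • gS q • A q := fun q => by
      by_cases h1 : q = qT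
      · subst h1
        simp only [hgV, hgS, hA', hw, hT, if_true, if_neg hKT.symm]
        module
      · by_cases h2 : q = qK
        · subst h2; simp [hgV, hgS, hK, h1]
        · simp [hgV, hgS, hA', hw, h1, h2]
    simp only [h]
    rw [Finset.sum_sub_distrib, hsumT, ← Finset.smul_sum]
    have h3 : ∑ q, gS q • A q = pT • S := by simp [hgS, ite_smul, hAT]
    rw [h3]
    module
  have q1 := sum_classFiber_mul_mul m A' t n hK hT sP sV
  have q2 := sum_classFiber_mul_mul m A' t n hK hT sU sS
  have q3 := sum_classFiber_mul_mul m A' t n hK hT sU sV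
  rw [eP, eV] at q1
  rw [eU, eS] at q2
  rw [eU, eV] at q3
  have hmain : θ * (2 * ∑ z ∈ classFiber cls t n,
        (∑ i, fP (z i)) * (∑ j, gV (z j)) * m (A' ∘ z)) -
      2 * ∑ z ∈ classFiber cls t n, (∑ i, fU (z i)) * (∑ j, gS (z j)) * m (A' ∘ z) ≤
      ((α - E) / (α + E) + 2 * d) * (2 * ∑ z ∈ classFiber cls t n,
        (∑ i, fU (z i)) * (∑ j, gV (z j)) * m (A' ∘ z)) := by
    rw [q1, q2, q3, Finset.mul_sum, Finset.mul_sum, ← Finset.sum_sub_distrib]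
    refine Finset.sum_le_sum fun i _ => ?_
    rw [Finset.mul_sum, Finset.mul_sum, ← Finset.sum_sub_distrib]
    refine Finset.sum_le_sum fun j _ => ?_
    by_cases hij : i = j
    · simp [hij]
    simp only [ne_eq, hij, not_false_eq_true, dite_true]
    set β := pairForm m A' cls t n qK qT i j hij + (pairForm m A' cls t n qK qT i j hij).flip
      with hβ
    have h := pair_inequality β
      (fun x y => by
        simp only [hβ, LinearMap.add_apply, LinearMap.flip_apply]; exact add_comm _ _)
      (fun x y hx hy => by
        simp only [hβ, LinearMap.add_apply, LinearMap.flip_apply]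
        exact add_nonneg (pairForm_nonneg hm hA'0 cls t n qK qT hij hx hy)
          (pairForm_nonneg hm hA'0 cls t n qK qT hij hy hx))
      hP hPF hF hFe hS hSe hPS hθ hθ1 hd hα hE hE1
    have h' := mul_le_mul_of_nonneg_left h (mul_nonneg hpK hpT)
    simp only [map_smul, LinearMap.smul_apply, smul_eq_mul]
    nlinarith
  have r1 : ∀ z ∈ classFiber cls t n, (∑ i, fP (z i)) * (∑ j, gV (z j)) * m (A' ∘ z) =
      t * (∑ i, fP (z i)) * m (A' ∘ z) := fun z hz => by
    rw [hcount, (mem_classFiber.1 hz).1]; ring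
  have r2 : ∀ z ∈ classFiber cls t n, (∑ i, fU (z i)) * (∑ j, gS (z j)) * m (A' ∘ z) =
      n * (∑ i, gS (z i)) * m (A' ∘ z) := fun z hz => by
    rw [hcount, (mem_classFiber.1 hz).2]
  have r3 : ∀ z ∈ classFiber cls t n, (∑ i, fU (z i)) * (∑ j, gV (z j)) * m (A' ∘ z) =
      n * t * m (A' ∘ z) := fun z hz => by
    rw [hcount, hcount, (mem_classFiber.1 hz).1, (mem_classFiber.1 hz).2]
  rw [Finset.sum_congr rfl r1, Finset.sum_congr rfl r2, Finset.sum_congr rfl r3,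
    ← Finset.mul_sum] at hmain
  have r4 : ∑ z ∈ classFiber cls t n, (θ * t * (∑ i, fP (z i)) - n * (∑ i, gS (z i))) *
      m (A' ∘ z) = θ * ∑ z ∈ classFiber cls t n, t * (∑ i, fP (z i)) * m (A' ∘ z) -
        ∑ z ∈ classFiber cls t n, n * (∑ i, gS (z i)) * m (A' ∘ z) := by
    rw [Finset.mul_sum, ← Finset.sum_sub_distrib]
    exact Finset.sum_congr rfl fun z _ => by ring
  change ∑ z ∈ classFiber cls t n, (θ * t * (∑ i, fP (z i)) - n * (∑ i, gS (z i))) *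
      m (A' ∘ z) ≤ _
  rw [r4]
  linarith

/-- The moment generating function of `θ E_K / n - E_T / t`, where `E_K` and `E_T` are the numbers of
errors in key and test rounds, over the results with `t` test rounds and `n` key rounds. -/
theorem moment_le {m : MultilinearMap ℝ (fun _ : Fin N => V) ℝ}
    (hm : ∀ x, (∀ i, 0 ≤ x i) → 0 ≤ m x) {A : κ → V} (hA : ∀ q, 0 ≤ A q) {cls : κ → Label}
    {qK qT : κ} (hK : cls qK = .key) (hT : cls qT = .test) {e P S F : V} {pK pT θ d : ℝ}
    (hpK : 0 ≤ pK) (hpT : 0 ≤ pT)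
    (hP : 0 ≤ P) (hPF : P ≤ F) (hF : θ • e ≤ F) (hFe : F ≤ e) (hS : 0 ≤ S) (hSe : S ≤ e)
    (hPS : P - S ≤ d • e) (hθ : 0 ≤ θ) (hθ1 : θ ≤ 1) (hd : 0 ≤ d)
    (hAK : A qK = pK • P) (hAT : A qT = pT • S)
    (hsumK : ∑ q, (if cls q = .key then (1 : ℝ) else 0) • A q = pK • F)
    (hsumT : ∑ q, (if cls q = .test then (1 : ℝ) else 0) • A q = pT • e)
    {t n : ℕ} (ht : t ≠ 0) (hn : n ≠ 0) {l : ℝ} (hl : 0 ≤ l) :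
    ∑ z ∈ classFiber cls t n, Real.exp (l * (θ * (∑ i, if z i = qK then (1 : ℝ) else 0) / n -
        (∑ i, if z i = qT then (1 : ℝ) else 0) / t)) * m (A ∘ z) ≤
      Real.exp (2 * d * l + (1 / n + 1 / t) / 4 * l ^ 2) *
        ∑ z ∈ classFiber cls t n, m (A ∘ z) := by
  have ht' : (0 : ℝ) < t := by positivity
  have hn' : (0 : ℝ) < n := by positivity
  have hKT : qK ≠ qT := fun h => by rw [h, hT] at hK; exact absurd hK (by decide)
  refine sum_exp_le_of_deriv_le _ _ _ (fun l hl => ?_) hl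
  set w : κ → ℝ := fun q => if q = qK then Real.exp (l * θ / n) else
    if q = qT then Real.exp (-(l / t)) else 1 with hw
  have hexp : ∀ z : Fin N → κ, Real.exp (l * (θ * (∑ i, if z i = qK then (1 : ℝ) else 0) / n -
        (∑ i, if z i = qT then (1 : ℝ) else 0) / t)) * m (A ∘ z) =
      m ((fun q => w q • A q) ∘ z) := fun z => by
    have h1 : m ((fun q => w q • A q) ∘ z) = (∏ i, w (z i)) • m (A ∘ z) :=
      m.map_smul_univ (fun i => w (z i)) (A ∘ z)
    have h2 : ∀ q, w q = Real.exp (l * θ / n * (if q = qK then 1 else 0) -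
        l / t * (if q = qT then 1 else 0)) := fun q => by
      by_cases h3 : q = qK
      · subst h3; simp [hw, hKT]
      · by_cases h4 : q = qT
        · simp [hw, h4, hKT.symm]
        · simp [hw, h3, h4]
    rw [h1, smul_eq_mul]
    congr 1
    simp only [h2]
    rw [← Real.exp_sum, Finset.sum_sub_distrib, ← Finset.mul_sum, ← Finset.mul_sum]
    congr 1
    ring
  simp only [hexp]
  have hlθ : 0 ≤ l * θ / n := by positivity
  have hlt : -(l / t) ≤ 0 := neg_nonpos.2 (by positivity)
  have h := sum_classFiber_error_le hm hA hK hT hpK hpT hP hPF hF hFe hS hSe hPS hθ hθ1 hd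
    (Real.one_le_exp hlθ) (Real.exp_pos (-(l / t))) (Real.exp_le_one_iff.2 hlt) hAK hAT hsumK hsumT
    hw t n
  have hsum0 : 0 ≤ ∑ z ∈ classFiber cls t n, m ((fun q => w q • A q) ∘ z) := by
    refine Finset.sum_nonneg fun z _ => ?_
    rw [← hexp]
    exact mul_nonneg (Real.exp_pos _).le (hm _ fun i => hA (z i))
  have hC := exp_sub_exp_div_le (hlt.trans hlθ)
  have hC2 : (l * θ / n - -(l / t)) / 2 ≤ 2 * ((1 / n + 1 / t) / 4) * l := by
    have : l * θ / n ≤ l / n := by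
      gcongr
      exact mul_le_of_le_one_right hl hθ1
    have e1 : 2 * ((1 / n + 1 / t) / 4) * l = (l / n + l / t : ℝ) / 2 := by ring
    rw [e1]
    linarith
  have hnt : (0 : ℝ) < n * t := by positivity
  refine le_of_mul_le_mul_left ?_ hnt
  calc (n * t : ℝ) * ∑ z ∈ classFiber cls t n, (θ * (∑ i, if z i = qK then (1 : ℝ) else 0) / n -
        (∑ i, if z i = qT then (1 : ℝ) else 0) / t) * m ((fun q => w q • A q) ∘ z)
      = _ := by
        rw [Finset.mul_sum]
        refine Finset.sum_congr rfl fun z _ => ?_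
        rw [← mul_assoc]
        congr 1
        field_simp
    _ ≤ _ := h
    _ ≤ (2 * d + 2 * ((1 / n + 1 / t) / 4) * l) * (n * t * ∑ z ∈ classFiber cls t n,
        m ((fun q => w q • A q) ∘ z)) :=
        mul_le_mul_of_nonneg_right (by linarith) (mul_nonneg hnt.le hsum0)
    _ = _ := by ring

end Moments

/-! ### The POVM of one round -/

section Round

variable {ι : Type*}

/-- The class of a result of a round.  A test round counts as soon as it passes the common filter,
whereas a key round counts only if it passes both filters. -/
def resultClass : Label × Outcome → Label
  | (.test, .commonReject) => .discard
  | (.test, _) => .test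
  | (.key, .error) => .key
  | (.key, .noError) => .key
  | (.key, _) => .discard
  | (.discard, _) => .discard

/-- The POVM element of a result of one round, including the probability of the label. -/
noncomputable def roundOp (M : Measurements ι) (pT pK : ℝ) (q : Label × Outcome) : Op ι :=
  labelProb pT pK q.1 • (star (kraus M q.1 q.2) * kraus M q.1 q.2)

theorem sum_label {V : Type*} [AddCommMonoid V] (f : Label → V) :
    ∑ l, f l = f .test + f .key + f .discard := by
  change ∑ l ∈ ({.test, .key, .discard} : Finset Label), f l = _
  simp [add_assoc]

theorem sum_outcome {V : Type*} [AddCommMonoid V] (f : Outcome → V) :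
    ∑ o, f o = f .commonReject + f .laterReject + f .error + f .noError := by
  change ∑ l ∈ ({.commonReject, .laterReject, .error, .noError} : Finset Outcome), f l = _
  simp [add_assoc]

theorem star_sqrt {κ : Type*} (P : Op κ) : star (CFC.sqrt P) = CFC.sqrt P :=
  (CFC.sqrt_nonneg P).isSelfAdjoint.star_eq

theorem IsEffect.one_sub {κ : Type*} {P : Op κ} (h : IsEffect P) : IsEffect (1 - P) :=
  ⟨sub_nonneg.2 h.2, sub_le_self _ h.1⟩

theorem sqrt_mul_mul_sqrt_nonneg {κ : Type*} {T : Op κ} (P : Op κ) (hT : 0 ≤ T) :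
    0 ≤ CFC.sqrt P * T * CFC.sqrt P := by
  have h := star_left_conjugate_nonneg hT (CFC.sqrt P)
  rwa [star_sqrt] at h

theorem sqrt_mul_mul_sqrt_mono {κ : Type*} {S T : Op κ} (P : Op κ) (h : S ≤ T) :
    CFC.sqrt P * S * CFC.sqrt P ≤ CFC.sqrt P * T * CFC.sqrt P := by
  have h := star_left_conjugate_le_conjugate h (CFC.sqrt P)
  rwa [star_sqrt] at h

theorem sqrt_mul_one_mul_sqrt {κ : Type*} {P : Op κ} (hP : 0 ≤ P) :
    CFC.sqrt P * 1 * CFC.sqrt P = P := by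
  rw [mul_one, CFC.sqrt_mul_sqrt_self P hP]

theorem sqrt_mul_mul_sqrt_le {κ : Type*} {P G : Op κ} (hP : 0 ≤ P) (hG : G ≤ 1) :
    CFC.sqrt P * G * CFC.sqrt P ≤ P := by
  have h := sqrt_mul_mul_sqrt_mono P hG
  rwa [sqrt_mul_one_mul_sqrt hP] at h

section Chain

variable {C F G : Op ι} (hC : IsEffect C) (hF : IsEffect F) (hG : IsEffect G)

include hC in
theorem krausChain_commonReject :
    star (krausChain C F G .commonReject) * krausChain C F G .commonReject = 1 - C := by
  rw [krausChain, star_sqrt, CFC.sqrt_mul_sqrt_self _ hC.one_sub.1]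

include hF in
theorem krausChain_laterReject :
    star (krausChain C F G .laterReject) * krausChain C F G .laterReject =
      CFC.sqrt C * (1 - F) * CFC.sqrt C := by
  rw [krausChain, star_mul, star_sqrt, star_sqrt]
  nth_rewrite 3 [← CFC.sqrt_mul_sqrt_self _ hF.one_sub.1]
  simp only [mul_assoc]

include hG in
theorem krausChain_error :
    star (krausChain C F G .error) * krausChain C F G .error =
      CFC.sqrt C * (CFC.sqrt F * G * CFC.sqrt F) * CFC.sqrt C := by
  rw [krausChain, star_mul, star_mul, star_sqrt, star_sqrt, star_sqrt]
  conv_rhs => enter [1, 2, 1, 2]; rw [← CFC.sqrt_mul_sqrt_self G hG.1]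
  simp only [mul_assoc]

include hF hG in
theorem krausChain_noError :
    star (krausChain C F G .noError) * krausChain C F G .noError =
      CFC.sqrt C * (F - CFC.sqrt F * G * CFC.sqrt F) * CFC.sqrt C := by
  have h : F - CFC.sqrt F * G * CFC.sqrt F = CFC.sqrt F * (1 - G) * CFC.sqrt F := by
    rw [mul_sub, sub_mul, sqrt_mul_one_mul_sqrt hF.1]
  rw [h, krausChain, star_mul, star_mul, star_sqrt, star_sqrt, star_sqrt]
  conv_rhs => enter [1, 2, 1, 2]; rw [← CFC.sqrt_mul_sqrt_self _ hG.one_sub.1]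
  simp only [mul_assoc]

end Chain

variable {M : Measurements ι} (hM : M.Valid) {pT pK : ℝ}

include hM in
theorem sum_roundOp : ∑ q, roundOp M pT pK q = 1 := by
  have hchain : ∀ {F G : Op ι}, IsEffect F → IsEffect G →
      ∑ o, star (krausChain M.Fcom F G o) * krausChain M.Fcom F G o = 1 := fun {F G} hF hG => by
    rw [sum_outcome, krausChain_commonReject hM.Fcom, krausChain_laterReject hF,
      krausChain_error hG, krausChain_noError hF hG, add_assoc, add_assoc, ← add_mul, ← mul_add,
      add_sub_cancel, ← add_mul, ← mul_add, sub_add_cancel, sqrt_mul_one_mul_sqrt hM.Fcom.1,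
      sub_add_cancel]
  have hl : ∀ l, ∑ o, star (kraus M l o) * kraus M l o = 1 := by
    intro l
    cases l
    · exact hchain hM.Ftest hM.Gtest
    · exact hchain hM.Fkey hM.Gkey
    · rw [sum_outcome]
      simp only [kraus, star_sqrt, CFC.sqrt_mul_sqrt_self _ hM.Fcom.one_sub.1,
        CFC.sqrt_mul_sqrt_self _ hM.Fcom.1, mul_zero, add_zero, sub_add_cancel]
  simp only [Fintype.sum_prod_type, roundOp, ← Finset.smul_sum, hl]
  rw [sum_label]
  simp only [labelProb]
  module

include hM in
theorem sum_roundOp_test :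
    ∑ q, (if resultClass q = .test then (1 : ℝ) else 0) • roundOp M pT pK q = pT • M.Fcom := by
  rw [Fintype.sum_prod_type, sum_label]
  simp only [sum_outcome, resultClass, roundOp, kraus, labelProb, if_true, if_false, one_smul,
    zero_smul, zero_add, add_zero, reduceCtorEq, krausChain_laterReject hM.Ftest,
    krausChain_error hM.Gtest, krausChain_noError hM.Ftest hM.Gtest]
  rw [← smul_add, ← smul_add, add_assoc, ← add_mul, ← mul_add, add_sub_cancel, ← add_mul, ← mul_add,
    sub_add_cancel, sqrt_mul_one_mul_sqrt hM.Fcom.1]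

include hM in
theorem sum_roundOp_key :
    ∑ q, (if resultClass q = .key then (1 : ℝ) else 0) • roundOp M pT pK q =
      pK • (CFC.sqrt M.Fcom * M.Fkey * CFC.sqrt M.Fcom) := by
  rw [Fintype.sum_prod_type, sum_label]
  simp only [sum_outcome, resultClass, roundOp, kraus, labelProb, if_true, if_false, one_smul,
    zero_smul, zero_add, add_zero, reduceCtorEq,
    krausChain_error hM.Gkey, krausChain_noError hM.Fkey hM.Gkey]
  rw [← smul_add, ← add_mul, ← mul_add, add_sub_cancel]

theorem roundOp_nonneg (hpT : 0 ≤ pT) (hpK : 0 ≤ pK) (hp : pT + pK ≤ 1) (q : Label × Outcome) :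
    0 ≤ roundOp M pT pK q := by
  refine smul_nonneg ?_ (star_mul_self_nonneg _)
  rcases q with ⟨_ | _ | _, _⟩
  · exact hpT
  · exact hpK
  · change 0 ≤ 1 - pT - pK
    linarith

end Round

/-! ### Reduction of the event -/

section Event

theorem gammaBin_nonneg (ε : ℝ) (n : ℕ) (δ : ℝ) : 0 ≤ gammaBin ε n δ :=
  Real.sInf_nonneg fun _ hc => hc.1

theorem sqrt_le_gammaSerf {ε : ℝ} (hε : 0 ≤ Real.log (1 / ε ^ 2)) {k t n : ℕ} (hk : k ≠ 0)
    (hkt : k ≤ t) (hn : n ≠ 0) :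
    Real.sqrt (Real.log (1 / ε ^ 2) * (1 / n + 1 / t)) ≤ gammaSerf ε k n := by
  refine Real.sqrt_le_sqrt ?_
  have hk' : (0 : ℝ) < k := by positivity
  have hn' : (0 : ℝ) < n := by positivity
  have hkt' : (k : ℝ) ≤ t := by exact_mod_cast hkt
  rw [div_eq_mul_inv]
  refine mul_le_mul_of_nonneg_left ?_ hε
  have h1 : (fSerf k n)⁻¹ = (1 / n + 1 / k) * ((k + 1) / k) := by
    rw [fSerf]; field_simp; ring
  rw [h1]
  have h2 : (1 : ℝ) ≤ (k + 1) / k := by rw [le_div_iff₀ hk']; linarith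
  have h3 : (1 / t : ℝ) ≤ 1 / k := one_div_le_one_div_of_le hk' hkt'
  have h4 : (0 : ℝ) ≤ 1 / n + 1 / k := by positivity
  nlinarith

/-- If the bound is finite and at most the error rate `eK / n` of the key rounds, then the error rates
deviate by at least a Hoeffding-type term plus `δ₁`, even if the test errors are counted relative to a
number `t` of test rounds larger than the number `k` of those that are kept. -/
theorem le_of_bound_le {εa εb εc δ₁ δ₂ : ℝ} (hε : 0 ≤ Real.log (1 / εa ^ 2)) {eT eK : ℕ}
    {k t n : ℕ} (hkt : k ≤ t)
    (h : bound εa εb εc δ₁ δ₂ (eT / k) k n ≤ ((eK / n : ℝ) : EReal)) :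
    t ≠ 0 ∧ n ≠ 0 ∧ Real.sqrt (Real.log (1 / εa ^ 2) * (1 / n + 1 / t)) + δ₁ ≤
      (1 - δ₂) * eK / n - eT / t := by
  rw [bound] at h
  split_ifs at h with h0
  · exact absurd (top_le_iff.1 h) (EReal.coe_ne_top _)
  push Not at h0
  obtain ⟨hk, hn, hD⟩ := h0
  rw [EReal.coe_le_coe_iff, div_le_iff₀ hD] at h
  refine ⟨by omega, hn, ?_⟩
  have h1 := sqrt_le_gammaSerf hε hk hkt hn
  have h2 := gammaBin_nonneg εb n δ₁
  have h3 := gammaBin_nonneg εc n δ₂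
  have h4 : (eT / t : ℝ) ≤ eT / k := by
    have : (k : ℝ) ≤ t := by exact_mod_cast hkt
    have : (0 : ℝ) < k := by positivity
    gcongr
  have h5 : (0 : ℝ) ≤ eK / n := by positivity
  have h6 : (1 - δ₂) * eK / n = eK / n * (1 - δ₂) := by ring
  rw [h6]
  nlinarith

variable {N : ℕ} (z : Fin N → Label × Outcome)

/-- The event that the error rate of the key rounds reaches the bound. -/
def ErrorRateExceedsBound {ι : Type*} (M : Measurements ι) (εa εb εc : ℝ)
    (z : Fin N → Label × Outcome) : Prop :=
  bound εa εb εc (delta1 M) (delta2 M)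
      (errorRate .test (fun i => (z i).1) (fun i => (z i).2))
      (numKept .test (fun i => (z i).1) (fun i => (z i).2))
      (numKept .key (fun i => (z i).1) (fun i => (z i).2)) ≤
    ((errorRate .key (fun i => (z i).1) (fun i => (z i).2) : ℝ) : EReal)

theorem numKept_test_le :
    numKept .test (fun i => (z i).1) (fun i => (z i).2) ≤ classCount resultClass .test z := by
  refine Finset.card_le_card fun i hi => ?_
  simp only [Finset.mem_filter, Finset.mem_univ, true_and] at hi ⊢
  obtain ⟨h1, h2⟩ := hi
  generalize z i = q at *
  obtain ⟨l, o⟩ := q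
  cases l <;> cases o <;> simp_all [resultClass]

theorem numKept_key_eq :
    numKept .key (fun i => (z i).1) (fun i => (z i).2) = classCount resultClass .key z := by
  refine congrArg Finset.card (Finset.filter_congr fun i _ => ?_)
  rcases h : z i with ⟨l, o⟩
  cases l <;> cases o <;> simp [h, resultClass]

theorem numError_eq (l : Label) :
    (numError l (fun i => (z i).1) (fun i => (z i).2) : ℝ) =
      ∑ i, if z i = (l, .error) then (1 : ℝ) else 0 := by
  simp [numError, Prod.ext_iff]

theorem ErrorRateExceedsBound.deviation_le {ι : Type*} {M : Measurements ι} {εa εb εc : ℝ}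
    {z : Fin N → Label × Outcome} (h : ErrorRateExceedsBound M εa εb εc z)
    (hε : 0 ≤ Real.log (1 / εa ^ 2)) {t n : ℕ} (hz : z ∈ classFiber resultClass t n) :
    t ≠ 0 ∧ n ≠ 0 ∧ Real.sqrt (Real.log (1 / εa ^ 2) * (1 / n + 1 / t)) + delta1 M ≤
      (1 - delta2 M) * (∑ i, if z i = (.key, .error) then (1 : ℝ) else 0) / n -
        (∑ i, if z i = (.test, .error) then (1 : ℝ) else 0) / t := by
  obtain ⟨rfl, rfl⟩ := mem_classFiber.1 hz
  rw [← numError_eq, ← numError_eq, ← numKept_key_eq]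
  exact le_of_bound_le hε (numKept_test_le z) h

end Event

/-! ### The tail bound -/

section Tail

variable {ι : Type*} {N : ℕ}

open Classical in
/-- Given that `t` test rounds pass the common filter and `n` key rounds pass both filters, the event has
conditional probability at most `εa ^ 2`. -/
theorem sum_classFiber_bound_le {m : MultilinearMap ℝ (fun _ : Fin N => Op ι) ℝ}
    (hm : ∀ x, (∀ i, 0 ≤ x i) → 0 ≤ m x) {M : Measurements ι} (hM : M.Valid)
    {pT pK : ℝ} (hpT : 0 ≤ pT) (hpK : 0 ≤ pK) (hp : pT + pK ≤ 1)
    {εa : ℝ} (hεa : 0 < εa) (εb εc : ℝ) (t n : ℕ) :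
    ∑ z ∈ classFiber resultClass t n,
        (if ErrorRateExceedsBound M εa εb εc z then m (roundOp M pT pK ∘ z) else 0) ≤
      εa ^ 2 * ∑ z ∈ classFiber resultClass t n, m (roundOp M pT pK ∘ z) := by
  have hA := roundOp_nonneg (M := M) hpT hpK hp
  have hm0 : ∀ z : Fin N → Label × Outcome, 0 ≤ m (roundOp M pT pK ∘ z) :=
    fun z => hm _ fun i => hA (z i)
  have hε2 : 0 < εa ^ 2 := by positivity
  rw [Finset.mul_sum]
  -- for `εa > 1` the claim is trivial
  rcases lt_or_ge (Real.log (1 / εa ^ 2)) 0 with hL | hL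
  · have h1 : 1 ≤ εa ^ 2 := by
      rw [one_div, Real.log_inv, neg_lt_zero] at hL
      exact ((Real.log_pos_iff hε2.le).1 hL).le
    refine Finset.sum_le_sum fun z _ => ?_
    split_ifs
    · exact le_mul_of_one_le_left (hm0 z) h1
    · exact mul_nonneg hε2.le (hm0 z)
  set L := Real.log (1 / εa ^ 2) with hLdef
  have hexpL : Real.exp (-L) = εa ^ 2 := by
    rw [hLdef, one_div, Real.log_inv, neg_neg, Real.exp_log hε2]
  -- without test rounds or key rounds the bound is infinite
  by_cases htn : t = 0 ∨ n = 0
  · refine Finset.sum_le_sum fun z hz => ?_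
    rw [if_neg]
    · exact mul_nonneg hε2.le (hm0 z)
    · intro h
      obtain ⟨h1, h2, -⟩ := h.deviation_le hL hz
      tauto
  push Not at htn
  obtain ⟨ht, hn⟩ := htn
  have ht' : (0 : ℝ) < t := by positivity
  have hn' : (0 : ℝ) < n := by positivity
  set γ := Real.sqrt (L * (1 / n + 1 / t)) with hγ
  set d := ‖CFC.sqrt M.Fkey * M.Gkey * CFC.sqrt M.Fkey -
    CFC.sqrt M.Ftest * M.Gtest * CFC.sqrt M.Ftest‖ with hd
  have hd1 : delta1 M = 2 * d := rfl
  -- the exponent that balances the linear and the quadratic term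
  set l := 2 * γ / (1 / n + 1 / t) with hl
  have hl0 : 0 ≤ l := by positivity
  have hδ2 : delta2 M ≤ 1 :=
    (CStarAlgebra.norm_le_one_iff_of_nonneg _ hM.Fkey.one_sub.1).2 hM.Fkey.one_sub.2
  have hmom := moment_le (κ := Label × Outcome) hm hA (cls := resultClass) (qK := (.key, .error))
    (qT := (.test, .error)) rfl rfl (e := M.Fcom)
    (P := CFC.sqrt M.Fcom * (CFC.sqrt M.Fkey * M.Gkey * CFC.sqrt M.Fkey) * CFC.sqrt M.Fcom)
    (S := CFC.sqrt M.Fcom * (CFC.sqrt M.Ftest * M.Gtest * CFC.sqrt M.Ftest) * CFC.sqrt M.Fcom)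
    (F := CFC.sqrt M.Fcom * M.Fkey * CFC.sqrt M.Fcom)
    (θ := 1 - delta2 M) (d := d) hpK hpT
    (sqrt_mul_mul_sqrt_nonneg _ (sqrt_mul_mul_sqrt_nonneg _ hM.Gkey.1))
    (sqrt_mul_mul_sqrt_mono _ (sqrt_mul_mul_sqrt_le hM.Fkey.1 hM.Gkey.2))
    (by
      have h1 : (1 : Op ι) - M.Fkey ≤ algebraMap ℝ (Op ι) ‖1 - M.Fkey‖ :=
        IsSelfAdjoint.le_algebraMap_norm_self hM.Fkey.one_sub.1.isSelfAdjoint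
      have h2 : (1 - delta2 M) • (1 : Op ι) ≤ M.Fkey := by
        rw [Algebra.algebraMap_eq_smul_one] at h1
        rw [sub_smul, one_smul]
        exact sub_le_comm.1 h1
      have h3 := sqrt_mul_mul_sqrt_mono M.Fcom h2
      rwa [mul_smul_comm, smul_mul_assoc, sqrt_mul_one_mul_sqrt hM.Fcom.1] at h3)
    (sqrt_mul_mul_sqrt_le hM.Fcom.1 hM.Fkey.2)
    (sqrt_mul_mul_sqrt_nonneg _ (sqrt_mul_mul_sqrt_nonneg _ hM.Gtest.1))
    (sqrt_mul_mul_sqrt_le hM.Fcom.1 ((sqrt_mul_mul_sqrt_le hM.Ftest.1 hM.Gtest.2).trans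
      hM.Ftest.2))
    (by
      have h1 : CFC.sqrt M.Fkey * M.Gkey * CFC.sqrt M.Fkey -
          CFC.sqrt M.Ftest * M.Gtest * CFC.sqrt M.Ftest ≤ algebraMap ℝ (Op ι) d :=
        IsSelfAdjoint.le_algebraMap_norm_self
          ((sqrt_mul_mul_sqrt_nonneg _ hM.Gkey.1).isSelfAdjoint.sub
            (sqrt_mul_mul_sqrt_nonneg _ hM.Gtest.1).isSelfAdjoint)
      rw [Algebra.algebraMap_eq_smul_one] at h1
      have h3 := sqrt_mul_mul_sqrt_mono M.Fcom h1
      rwa [mul_smul_comm, smul_mul_assoc, sqrt_mul_one_mul_sqrt hM.Fcom.1, mul_sub, sub_mul] at h3)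
    (sub_nonneg.2 hδ2) (sub_le_self _ (norm_nonneg _)) (norm_nonneg _)
    (congrArg (pK • ·) (krausChain_error hM.Gkey))
    (congrArg (pT • ·) (krausChain_error hM.Gtest))
    (sum_roundOp_key hM) (sum_roundOp_test hM) ht hn hl0
  have hexp : -(l * (γ + 2 * d)) + (2 * d * l + (1 / n + 1 / t) / 4 * l ^ 2) = -L := by
    have hγ2 : γ ^ 2 = L * (1 / n + 1 / t) := Real.sq_sqrt (by positivity)
    have hw : (0 : ℝ) < 1 / n + 1 / t := by positivity
    generalize (1 / n + 1 / t : ℝ) = w at *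
    rw [hl]
    field_simp
    linear_combination (-4) * hγ2
  rw [← Finset.mul_sum]
  refine le_trans ?_ (le_of_le_of_eq
    (mul_le_mul_of_nonneg_left hmom (Real.exp_pos (-(l * (γ + 2 * d)))).le) ?_)
  · rw [Finset.mul_sum]
    refine Finset.sum_le_sum fun z hz => ?_
    split_ifs with h
    · obtain ⟨-, -, h3⟩ := h.deviation_le hL hz
      rw [hd1] at h3
      rw [← mul_assoc, ← Real.exp_add]
      refine le_mul_of_one_le_left (hm0 z) (Real.one_le_exp ?_)
      have := mul_le_mul_of_nonneg_left h3 hl0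
      linarith
    · exact mul_nonneg (Real.exp_pos _).le (mul_nonneg (Real.exp_pos _).le (hm0 z))
  · rw [← mul_assoc, ← Real.exp_add, hexp, hexpL]

end Tail

end QKDSampling

open QKDSampling in
theorem theorem2 {ι : Type*} (n : ℕ) (ρ : QKDSampling.Op (Fin n → ι))
    (hρ : QKDSampling.IsState ρ) (M : QKDSampling.Measurements ι) (hM : M.Valid)
    (pT pK : ℝ) (hpT : 0 ≤ pT) (hpK : 0 ≤ pK) (hp : pT + pK ≤ 1)
    (εa εb εc : ℝ) (hεa : 0 < εa) (hεb : 0 < εb) (hεc : 0 < εc) :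
    QKDSampling.prob M pT pK ρ (fun s o =>
      QKDSampling.bound εa εb εc (QKDSampling.delta1 M) (QKDSampling.delta2 M)
          (QKDSampling.errorRate .test s o) (QKDSampling.numKept .test s o)
          (QKDSampling.numKept .key s o) ≤
        ((QKDSampling.errorRate .key s o : ℝ) : EReal)) ≤
      ENNReal.ofReal (εa ^ 2 + εb ^ 2 + εc ^ 2) := by
  classical
  obtain ⟨ω, hω, hω1, hωK⟩ := hρ.exists_expectation
  set m : MultilinearMap ℝ (fun _ : Fin n => Op ι) ℝ :=
    ω.compMultilinearMap (tensorMap n ι) with hm_def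
  have hm : ∀ x : Fin n → Op ι, (∀ i, 0 ≤ x i) → 0 ≤ m x := fun x hx =>
    hω _ (tensorOp_nonneg hx)
  have hA := roundOp_nonneg (M := M) hpT hpK hp
  have hjoint : ∀ z : Fin n → Label × Outcome,
      jointProb M pT pK ρ (fun i => (z i).1) (fun i => (z i).2) =
        ENNReal.ofReal (m (roundOp M pT pK ∘ z)) := fun z => by
    have h1 : m (roundOp M pT pK ∘ z) = (∏ i, labelProb pT pK (z i).1) •
        m (fun i => star (kraus M (z i).1 (z i).2) * kraus M (z i).1 (z i).2) :=
      m.map_smul_univ _ _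
    have h2 : 0 ≤ ∏ i, labelProb pT pK (z i).1 := Finset.prod_nonneg fun i _ => by
      cases (z i).1
      · exact hpT
      · exact hpK
      · change 0 ≤ 1 - pT - pK
        linarith
    rw [h1, smul_eq_mul, ENNReal.ofReal_mul h2, jointProb, hωK, star_tensorOp, ← tensorOp_mul]
    rfl
  have htotal : ∑ z : Fin n → Label × Outcome, m (roundOp M pT pK ∘ z) = 1 := by
    have h1 := m.map_sum (fun (_ : Fin n) (q : Label × Outcome) => roundOp M pT pK q)
    simp only [sum_roundOp hM] at h1
    refine h1.symm.trans ?_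
    change ω (tensorOp 1) = 1
    rw [tensorOp_one, hω1]
  have hprob : prob M pT pK ρ (fun s o =>
      bound εa εb εc (delta1 M) (delta2 M) (errorRate .test s o) (numKept .test s o)
        (numKept .key s o) ≤ ((errorRate .key s o : ℝ) : EReal)) =
      ENNReal.ofReal
        (∑ z, if ErrorRateExceedsBound M εa εb εc z then m (roundOp M pT pK ∘ z) else 0) := by
    rw [ENNReal.ofReal_sum_of_nonneg]
    · rw [prob, ← Fintype.sum_prod_type']
      refine Fintype.sum_equiv (Equiv.arrowProdEquivProdArrow _ _ _).symm _ _ fun x => ?_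
      rw [apply_ite ENNReal.ofReal, ← hjoint, ENNReal.ofReal_zero]
      split_ifs with h1 h2 h2
      exacts [rfl, absurd h1 h2, absurd h2 h1, rfl]
    · intro z _
      split_ifs
      · exact hm _ fun i => hA (z i)
      · exact le_rfl
  rw [hprob]
  refine ENNReal.ofReal_le_ofReal ?_
  have hfib : ∀ f : (Fin n → Label × Outcome) → ℝ, ∑ z, f z =
      ∑ p ∈ Finset.univ.image fun z : Fin n → Label × Outcome =>
        (classCount resultClass .test z, classCount resultClass .key z),
        ∑ z ∈ classFiber resultClass p.1 p.2, f z := fun f => by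
    rw [← Finset.sum_fiberwise_of_maps_to (g := fun z : Fin n → Label × Outcome =>
      (classCount resultClass .test z, classCount resultClass .key z))
      (fun z _ => Finset.mem_image_of_mem _ (Finset.mem_univ z))]
    refine Finset.sum_congr rfl fun p _ => Finset.sum_congr ?_ fun _ _ => rfl
    ext z
    simp [mem_classFiber, Prod.ext_iff]
  calc ∑ z, (if ErrorRateExceedsBound M εa εb εc z then m (roundOp M pT pK ∘ z) else 0)
      ≤ εa ^ 2 * ∑ z, m (roundOp M pT pK ∘ z) := by
        rw [hfib, hfib (fun z => m (roundOp M pT pK ∘ z)), Finset.mul_sum]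
        exact Finset.sum_le_sum fun p _ =>
          sum_classFiber_bound_le hm hM hpT hpK hp hεa εb εc p.1 p.2
    _ = εa ^ 2 := by rw [htotal, mul_one]
    _ ≤ εa ^ 2 + εb ^ 2 + εc ^ 2 := by nlinarith [sq_nonneg εb, sq_nonneg εc]
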